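/- Let $d\ge 1$. Let $\{\omega_j\}_{j\in\mathbb Z^d}$ be independent, identically distributed real random variables on a probability space $(\Omega,\mathbb P)$ with $0\le\omega_0\le 1$ and $\mathbb E\{\omega_0\}>0$. Let $u\in L^\infty(\mathbb R^d)$ have compact support and satisfy $0\le u\le u_0$ for a constant $u_0>0$ and $\int_{\mathbb R^d}u(x)\,dx>0$, and put $$V_\omega(x):=-\sum_{j\in\mathbb Z^d}\omega_j\,u(x-j).$$ Let $0\le\gamma\in L^\infty(\mathbb R^d)$ with $\lim_{|x|\to\infty}\gamma(x)=0$, and let $H_\omega(\gamma):=-\Delta+\gamma V_\omega$ on $L^2(\mathbb R^d)$, with the domain of the Laplacian. Suppose that $$\gamma(x)\,|x|^2\ge F(|x|)\quad\text{for all }|x|>R_0,$$ where $R_0>0$ and $F\colon[R_0,\infty[\,\to\,]0,\infty[$ is a strictly increasing function such that $\lim_{r\to\infty}F(r)=\infty$ and $\lim_{r\to\infty}F(r)/r^2=0$. (Pointwise conditions on $u$ and $\gamma$ are understood up to Lebesgue-null sets.) Then, for $\mathbb P$-almost every $\omega\in\Omega$, $H_\omega(\gamma)$ has infinitely many distinct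 eigenvalues in $]-\infty,0[$. -/

import Mathlib

open MeasureTheory ProbabilityTheory Filter Topology Set
open scoped ENNReal SchwartzMap Laplacian

noncomputable section

namespace RandomSchrodinger

/-- The Euclidean space `ℝ^d`. -/
abbrev Space (d : ℕ) : Type := EuclideanSpace ℝ (Fin d)

/-- The complex Hilbert space `L²(ℝ^d)`. -/
abbrev L2 (d : ℕ) : Type := Lp ℂ 2 (volume : Measure (Space d))

/-- `L²(ℝ^d)` as a space of tempered distributions, linearly. -/
def toDist (d : ℕ) : L2 d →ₗ[ℂ] 𝓢'(Space d, ℂ) :=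
  (Lp.toTemperedDistributionCLM ℂ (volume : Measure (Space d)) 2).toLinearMap

theorem toDist_apply {d : ℕ} (f : L2 d) : toDist d f = (f : 𝓢'(Space d, ℂ)) := rfl

theorem toDist_injective (d : ℕ) : Function.Injective (toDist d) :=
  LinearMap.ker_eq_bot.mp Lp.ker_toTemperedDistributionCLM_eq_bot

/-- The self-adjoint realization of the Laplacian on `L²(ℝ^d)`: its domain consists of all
`f ∈ L²` whose distributional Laplacian is (given by) an element of `L²`, which is then the value
of the operator at `f`. -/
def laplacian (d : ℕ) : L2 d →ₗ.[ℂ] L2 d where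
  domain := (LinearMap.range (toDist d)).comap
    ((LineDeriv.laplacianCLM ℂ (Space d) 𝓢'(Space d, ℂ)).toLinearMap ∘ₗ toDist d)
  toFun := (LinearEquiv.ofInjective (toDist d) (toDist_injective d)).symm.toLinearMap ∘ₗ
    ((LineDeriv.laplacianCLM ℂ (Space d) 𝓢'(Space d, ℂ)).toLinearMap ∘ₗ toDist d).restrict
      (fun _ hf => hf)

theorem mem_laplacian_domain {d : ℕ} {f : L2 d} :
    f ∈ (laplacian d).domain ↔
      ∃ g : L2 d, Δ (f : 𝓢'(Space d, ℂ)) = (g : 𝓢'(Space d, ℂ)) := by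
  simp only [laplacian, Submodule.mem_comap, LinearMap.mem_range, LinearMap.comp_apply,
    toDist_apply, ContinuousLinearMap.coe_coe, TemperedDistribution.laplacianCLM_apply]
  exact ⟨fun ⟨g, hg⟩ => ⟨g, hg.symm⟩, fun ⟨g, hg⟩ => ⟨g, hg.symm⟩⟩

theorem laplacian_apply {d : ℕ} (f : (laplacian d).domain) :
    ((laplacian d f : L2 d) : 𝓢'(Space d, ℂ)) = Δ ((f : L2 d) : 𝓢'(Space d, ℂ)) := by
  have h := LinearEquiv.apply_symm_apply
    (LinearEquiv.ofInjective (toDist d) (toDist_injective d))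
    (((LineDeriv.laplacianCLM ℂ (Space d) 𝓢'(Space d, ℂ)).toLinearMap ∘ₗ toDist d).restrict
      (fun _ hf => hf) f)
  have h' := congrArg Subtype.val h
  rw [← TemperedDistribution.laplacianCLM_apply]
  exact h'

theorem mul_add_ae {d : ℕ} (W : Space d → ℝ) (f g : L2 d) :
    (fun x => (W x : ℂ) * (f + g : L2 d) x) =ᵐ[volume]
      (fun x => (W x : ℂ) * f x) + fun x => (W x : ℂ) * g x := by
  filter_upwards [Lp.coeFn_add f g] with x hx
  rw [hx, Pi.add_apply, Pi.add_apply, mul_add]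

theorem mul_smul_ae {d : ℕ} (W : Space d → ℝ) (c : ℂ) (f : L2 d) :
    (fun x => (W x : ℂ) * (c • f : L2 d) x) =ᵐ[volume] c • fun x => (W x : ℂ) * f x := by
  filter_upwards [Lp.coeFn_smul c f] with x hx
  rw [hx, Pi.smul_apply, Pi.smul_apply, smul_eq_mul, smul_eq_mul, mul_left_comm]

/-- The maximal domain of multiplication by `W`: all `f ∈ L²` such that `W f ∈ L²`. -/
def mulDomain {d : ℕ} (W : Space d → ℝ) : Submodule ℂ (L2 d) where
  carrier := {f | MemLp (fun x => (W x : ℂ) * f x) 2 volume}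
  zero_mem' := by
    refine (memLp_congr_ae ?_).mpr (MemLp.zero (ε := ℂ) (p := 2) (μ := volume))
    filter_upwards [Lp.coeFn_zero ℂ 2 (volume : Measure (Space d))] with x hx
    rw [hx, Pi.zero_apply, mul_zero]
  add_mem' := fun {f g} hf hg => (memLp_congr_ae (mul_add_ae W f g)).mpr (MemLp.add hf hg)
  smul_mem' := fun c f hf => (memLp_congr_ae (mul_smul_ae W c f)).mpr (MemLp.const_smul hf c)

theorem mem_mulDomain {d : ℕ} {W : Space d → ℝ} {f : L2 d} :
    f ∈ mulDomain W ↔ MemLp (fun x => (W x : ℂ) * f x) 2 volume := Iff.rfl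

/-- The product `W f ∈ L²`, for `f` in the maximal domain. -/
def mulFun {d : ℕ} (W : Space d → ℝ) (f : mulDomain W) : L2 d :=
  MemLp.toLp (fun x => (W x : ℂ) * (f : L2 d) x) (mem_mulDomain.mp f.2)

theorem coeFn_mulFun {d : ℕ} (W : Space d → ℝ) (f : mulDomain W) :
    mulFun W f =ᵐ[volume] fun x => (W x : ℂ) * (f : L2 d) x :=
  MemLp.coeFn_toLp (mem_mulDomain.mp f.2)

/-- The maximal operator of multiplication by the real-valued function `W` on `L²(ℝ^d)`.
It is everywhere defined if `W ∈ L^∞`. -/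
def mulOp {d : ℕ} (W : Space d → ℝ) : L2 d →ₗ.[ℂ] L2 d where
  domain := mulDomain W
  toFun :=
    { toFun := mulFun W
      map_add' := by
        intro f g
        apply Lp.ext
        filter_upwards [coeFn_mulFun W (f + g), coeFn_mulFun W f, coeFn_mulFun W g,
          mul_add_ae W f g, Lp.coeFn_add (mulFun W f) (mulFun W g)] with x h1 h2 h3 h4 h5
        rw [h5, Pi.add_apply, h1, h2, h3]
        exact h4
      map_smul' := by
        intro c f
        apply Lp.ext
        filter_upwards [coeFn_mulFun W (c • f), coeFn_mulFun W f,
          mul_smul_ae W c f, Lp.coeFn_smul c (mulFun W f)] with x h1 h2 h3 h4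
        rw [RingHom.id_apply, h4, Pi.smul_apply, h1, h2]
        exact h3 }

/-- The Schrödinger operator `-Δ + W` on `L²(ℝ^d)`, defined on the intersection of the domains
of `Δ` and of multiplication by `W` (hence on the domain of `Δ` if `W ∈ L^∞`). -/
def schrodinger {d : ℕ} (W : Space d → ℝ) : L2 d →ₗ.[ℂ] L2 d :=
  -laplacian d + mulOp W

/-- `E` is an eigenvalue of the (unbounded) operator `A`. -/
def IsEigenvalue {H : Type*} [AddCommGroup H] [Module ℂ H] (A : H →ₗ.[ℂ] H) (E : ℝ) : Prop :=
  ∃ ψ : A.domain, (ψ : H) ≠ 0 ∧ A ψ = (E : ℂ) • (ψ : H)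

/-- The point of `ℝ^d` with integer coordinates `j`. -/
def latticePoint {d : ℕ} (j : Fin d → ℤ) : Space d := WithLp.toLp 2 (fun i => (j i : ℝ))

/-- The potential `x ↦ - ∑_{j ∈ ℤ^d} w_j u(x - j)`. -/
def potential {d : ℕ} (u : Space d → ℝ) (w : (Fin d → ℤ) → ℝ) (x : Space d) : ℝ :=
  -∑' j : Fin d → ℤ, w j * u (x - latticePoint j)

/-- The operator `-Δ + γ V` on `L²(ℝ^d)`, where `V = - ∑_{j ∈ ℤ^d} w_j u(· - j)`. -/
def hamiltonian {d : ℕ} (γ u : Space d → ℝ) (w : (Fin d → ℤ) → ℝ) : L2 d →ₗ.[ℂ] L2 d :=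
  schrodinger (fun x => γ x * potential u w x)

end RandomSchrodinger

end

/-! Write `H = -Δ - U` with `U = -γ V ≥ 0`, which is bounded and vanishes at infinity. The negative
spectrum is studied through the bounded resolvent `T = (H + M)⁻¹`, with `M` large compared with `sup
U`. If `G = (-Δ + M)⁻¹`, then `G ≤ 1/M` and `T = G + T U G`, where `U G` is compact. An eigenvalue
`l > 1/M` of `T` is an eigenvalue `1/l - M < 0` of `H`.

A symmetric operator of the form (something at most `c`) + (compact) has infinitely many eigenvalues
above `c` as soon as its form exceeds `c` on an infinite family orthogonal for both the form and the
inner product (`infinite_setOf_eigenvalue_gt`). The family used is `h = (H + M) φ` for test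
functions `φ` with disjoint supports: since `T h = φ` and `H` is local, both orthogonality relations
are automatic. What remains is that the potential energy of `φ` dominates a kinetic quantity
(`infinite_negative_eigenvalues`).

Dilated bumps of scale `R`, centred at distance `4 R` from the origin, have kinetic quantity at most
`C R ^ (d - 2)`. On the plateau `γ ≥ F (3 R) / (5 R) ^ 2`, so if the couplings have positive density
in a box of side comparable to `R` inside the plateau, the potential energy is at least `c F (3 R) R
^ (d - 2)`. This wins because `F` tends to infinity. The scales grow by factors of four, which
separates the supports.

The density holds almost surely in all but finitely many of the boxes, by Chebyshev and
Borel–Cantelli (`ae_eventually_le_sum`). Everything else is deterministic. -/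

noncomputable section

namespace RandomSchrodinger

/-! ### Eigenvalues of a compact perturbation above the bound of the unperturbed form. -/

section Spectral

variable {H : Type*} [NormedAddCommGroup H] [InnerProductSpace ℂ H]

open scoped InnerProductSpace

/-- Expand the nonnegative form at `f - b⁻¹ P f`. It turns an almost maximizing sequence of a
Rayleigh quotient into approximate eigenvectors. -/
theorem norm_sq_le_of_nonneg_form {P : H →L[ℂ] H} (hP : P.toLinearMap.IsSymmetric)
    (hpos : ∀ f, 0 ≤ (⟪P f, f⟫_ℂ).re) {b : ℝ} (hb : 0 < b) (hPb : ‖P‖ ≤ b) (f : H) :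
    ‖P f‖ ^ 2 ≤ b * (⟪P f, f⟫_ℂ).re := by
  have h := hpos (f - ((b⁻¹ : ℝ) : ℂ) • P f)
  have hs : ⟪P (P f), f⟫_ℂ = ⟪P f, P f⟫_ℂ := hP (P f) f
  have hn : (⟪P f, P f⟫_ℂ).re = ‖P f‖ ^ 2 := by
    simpa using inner_self_eq_norm_sq (𝕜 := ℂ) (P f)
  have h3 : (⟪P (P f), P f⟫_ℂ).re ≤ b * ‖P f‖ ^ 2 := by
    calc (⟪P (P f), P f⟫_ℂ).re ≤ ‖P (P f)‖ * ‖P f‖ := re_inner_le_norm (𝕜 := ℂ) _ _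
      _ ≤ (b * ‖P f‖) * ‖P f‖ := by
        gcongr
        exact P.le_of_opNorm_le hPb _
      _ = b * ‖P f‖ ^ 2 := by ring
  simp only [map_sub, map_smul, inner_sub_left, inner_sub_right, inner_smul_left,
    inner_smul_right, Complex.sub_re, Complex.conj_ofReal, Complex.re_ofReal_mul, hs, hn] at h
  have e : b⁻¹ * (b⁻¹ * (⟪P (P f), P f⟫_ℂ).re) ≤ b⁻¹ * ‖P f‖ ^ 2 := by
    gcongr
    rw [inv_mul_le_iff₀ hb]
    exact h3
  have h5 : b⁻¹ * ‖P f‖ ^ 2 ≤ (⟪P f, f⟫_ℂ).re := by linarith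
  rwa [inv_mul_le_iff₀ hb] at h5

theorem re_inner_smul_one_sub (G : H →L[ℂ] H) (l : ℝ) (f : H) :
    (⟪((l : ℂ) • (1 : H →L[ℂ] H) - G) f, f⟫_ℂ).re = l * ‖f‖ ^ 2 - (⟪G f, f⟫_ℂ).re := by
  have hn : (⟪f, f⟫_ℂ).re = ‖f‖ ^ 2 := by simpa using inner_self_eq_norm_sq (𝕜 := ℂ) f
  have h : ((l : ℂ) • (1 : H →L[ℂ] H) - G) f = (l : ℂ) • f - G f := rfl
  rw [h, inner_sub_left, inner_smul_left, Complex.sub_re, Complex.conj_ofReal,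
    Complex.re_ofReal_mul, hn]

theorem sub_mul_norm_le {G : H →L[ℂ] H} {c l : ℝ} (hG : ∀ f, (⟪G f, f⟫_ℂ).re ≤ c * ‖f‖ ^ 2)
    (f : H) : (l - c) * ‖f‖ ≤ ‖((l : ℂ) • (1 : H →L[ℂ] H) - G) f‖ := by
  rcases eq_or_ne f 0 with rfl | hf
  · simp
  have h1 := re_inner_smul_one_sub G l f
  have h2 := re_inner_le_norm (𝕜 := ℂ) (((l : ℂ) • (1 : H →L[ℂ] H) - G) f) f
  have h3 := hG f
  simp only [RCLike.re_to_complex] at h2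
  have hf' : 0 < ‖f‖ := norm_pos_iff.mpr hf
  nlinarith

/-- Cauchy–Schwarz bounds `l - G` below by `l - c`. Hence `l - G` is a closed embedding, through
which compactness of `K` passes to vectors. -/
theorem antilipschitzWith_smul_one_sub {G : H →L[ℂ] H} {c l : ℝ} (hcl : c < l)
    (hG : ∀ f, (⟪G f, f⟫_ℂ).re ≤ c * ‖f‖ ^ 2) :
    AntilipschitzWith (⟨(l - c)⁻¹, inv_nonneg.mpr (sub_pos.mpr hcl).le⟩ : NNReal)
      ((l : ℂ) • (1 : H →L[ℂ] H) - G) := by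
  refine AddMonoidHomClass.antilipschitz_of_bound _ fun x => ?_
  have := sub_mul_norm_le (l := l) hG x
  change ‖x‖ ≤ (l - c)⁻¹ * _
  rwa [le_inv_mul_iff₀ (sub_pos.mpr hcl)]

/-- A dimension count: among combinations of `finrank E + 1` of the `g n`, some nonzero coefficient
vector is killed by the projection onto `E`. Both quadratic forms are diagonal in the `g n`, so the
strict inequality survives. -/
theorem exists_mem_orthogonal_form_gt {B : H →L[ℂ] H} {c : ℝ} (E : Submodule ℂ H)
    [FiniteDimensional ℂ E] {g : ℕ → H} (hBg : ∀ n m, n ≠ m → ⟪B (g n), g m⟫_ℂ = 0)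
    (hg : ∀ n m, n ≠ m → ⟪g n, g m⟫_ℂ = 0)
    (hpos : ∀ n, c * ‖g n‖ ^ 2 < (⟪B (g n), g n⟫_ℂ).re) :
    ∃ h ∈ Eᗮ, c * ‖h‖ ^ 2 < (⟪B h, h⟫_ℂ).re := by
  set N := Module.finrank ℂ E + 1
  let Φ : (Fin N → ℂ) →ₗ[ℂ] H := Fintype.linearCombination ℂ (fun i : Fin N => g i)
  have hker : ((E.orthogonalProjectionOnto.toLinearMap) ∘ₗ Φ).ker ≠ ⊥ :=
    LinearMap.ker_ne_bot_of_finrank_lt (by simp [N])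
  obtain ⟨a, ha, ha0⟩ := Submodule.exists_mem_ne_zero_of_ne_bot hker
  have hΦ : Φ a = ∑ i, a i • g i := rfl
  have hdiag : ∀ (T : H →L[ℂ] H), (∀ n m, n ≠ m → ⟪T (g n), g m⟫_ℂ = 0) →
      (⟪T (Φ a), Φ a⟫_ℂ).re = ∑ i, ‖a i‖ ^ 2 * (⟪T (g i), g i⟫_ℂ).re := by
    intro T hT
    rw [hΦ, map_sum, sum_inner, Complex.re_sum]
    refine Finset.sum_congr rfl fun i _ => ?_
    rw [inner_sum, Finset.sum_eq_single i]
    · rw [map_smul, inner_smul_left, inner_smul_right, ← mul_assoc, mul_comm _ (a i),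
        Complex.mul_conj, Complex.normSq_eq_norm_sq, Complex.re_ofReal_mul]
    · intro j _ hj
      rw [map_smul, inner_smul_left, inner_smul_right,
        hT i j (fun h => hj (Fin.ext h.symm)), mul_zero, mul_zero]
    · simp
  refine ⟨Φ a, ?_, ?_⟩
  · rw [LinearMap.mem_ker] at ha
    exact Submodule.orthogonalProjectionOnto_eq_zero_iff.mp ha
  · have h1 := hdiag B hBg
    have h2 := hdiag 1 hg
    have hn : ∀ f : H, (⟪(1 : H →L[ℂ] H) f, f⟫_ℂ).re = ‖f‖ ^ 2 :=
      fun f => by simpa using inner_self_eq_norm_sq (𝕜 := ℂ) f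
    simp only [hn] at h2
    rw [h1, h2, Finset.mul_sum]
    obtain ⟨i, hi⟩ := Function.ne_iff.mp ha0
    refine Finset.sum_lt_sum (fun j _ => ?_) ⟨i, Finset.mem_univ _, ?_⟩
    · nlinarith [(hpos j).le, sq_nonneg ‖a j‖]
    · have : 0 < ‖a i‖ ^ 2 := by
        have := norm_pos_iff.mpr hi
        positivity
      nlinarith [hpos i]

variable [CompleteSpace H]

/-- If `B = G + K` is symmetric with `G ≤ c` and `K` compact, and if the form of `B - c` is
somewhere positive, then `B` has an eigenvalue above `c`. -/
theorem exists_eigenvalue_gt {B G K : H →L[ℂ] H} (hB : B.toLinearMap.IsSymmetric)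
    (hBGK : B = G + K) (hK : IsCompactOperator K) {c : ℝ}
    (hG : ∀ f, (⟪G f, f⟫_ℂ).re ≤ c * ‖f‖ ^ 2) {h : H} (hh : c * ‖h‖ ^ 2 < (⟪B h, h⟫_ℂ).re) :
    ∃ l : ℝ, c < l ∧ ∃ f : H, f ≠ 0 ∧ B f = (l : ℂ) • f := by
  have hh0 : h ≠ 0 := by
    rintro rfl
    simp at hh
  set S : Set ℝ := (fun f : H => (⟪B f, f⟫_ℂ).re) '' Metric.sphere 0 1 with hS
  have hbdd : BddAbove S := by
    refine ⟨‖B‖, ?_⟩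
    rintro _ ⟨f, hf, rfl⟩
    rw [mem_sphere_zero_iff_norm] at hf
    calc (⟪B f, f⟫_ℂ).re ≤ ‖B f‖ * ‖f‖ := re_inner_le_norm (𝕜 := ℂ) _ _
      _ ≤ (‖B‖ * ‖f‖) * ‖f‖ := by gcongr; exact B.le_opNorm f
      _ = ‖B‖ := by rw [hf]; ring
  have hscale : ∀ f : H, f ≠ 0 → (⟪B f, f⟫_ℂ).re / ‖f‖ ^ 2 ∈ S := by
    intro f hf
    have hf' : ‖f‖ ≠ 0 := norm_ne_zero_iff.mpr hf
    refine ⟨((‖f‖⁻¹ : ℝ) : ℂ) • f, ?_, ?_⟩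
    · rw [mem_sphere_zero_iff_norm, norm_smul]
      simp [hf']
    · simp only [map_smul, inner_smul_left, inner_smul_right, Complex.conj_ofReal,
        Complex.re_ofReal_mul]
      field_simp
  have hne : S.Nonempty := ⟨_, hscale h hh0⟩
  -- The candidate eigenvalue is the supremum of the Rayleigh quotient; it has to be shown that it
  -- is attained.
  set l := sSup S with hl
  have hle : ∀ f : H, (⟪B f, f⟫_ℂ).re ≤ l * ‖f‖ ^ 2 := by
    intro f
    rcases eq_or_ne f 0 with rfl | hf
    · simp
    · have := le_csSup hbdd (hscale f hf)
      rwa [div_le_iff₀ (by positivity)] at this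
  have hcl : c < l := by
    have h1 := le_csSup hbdd (hscale h hh0)
    refine lt_of_lt_of_le ?_ h1
    rwa [lt_div_iff₀ (by positivity)]
  refine ⟨l, hcl, ?_⟩
  obtain ⟨s, -, hs, hsS⟩ := exists_seq_tendsto_sSup hne hbdd
  choose f hf hfs using hsS
  have hf1 : ∀ n, ‖f n‖ = 1 := fun n => by simpa using hf n
  set P : H →L[ℂ] H := (l : ℂ) • (1 : H →L[ℂ] H) - B with hP
  have hPform : ∀ f, (⟪P f, f⟫_ℂ).re = l * ‖f‖ ^ 2 - (⟪B f, f⟫_ℂ).re :=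
    re_inner_smul_one_sub B l
  have hPapp : ∀ f, P f = (l : ℂ) • f - B f := fun f => rfl
  have hPsymm : P.toLinearMap.IsSymmetric := by
    intro x y
    have := hB x y
    simp only [ContinuousLinearMap.coe_coe] at this
    simp only [ContinuousLinearMap.coe_coe, hPapp, inner_sub_left, inner_sub_right,
      inner_smul_left, inner_smul_right, this, Complex.conj_ofReal]
  have hPf : Tendsto (fun n => P (f n)) atTop (𝓝 0) := by
    have h1 : Tendsto (fun n => (‖P‖ + 1) * (l - s n)) atTop (𝓝 0) := by
      have : Tendsto (fun n => (‖P‖ + 1) * (l - s n)) atTop (𝓝 ((‖P‖ + 1) * (l - l))) :=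
        (tendsto_const_nhds.sub hs).const_mul _
      simpa using this
    have h2 : Tendsto (fun n => ‖P (f n)‖ ^ 2) atTop (𝓝 0) := by
      refine squeeze_zero (fun n => by positivity) (fun n => ?_) h1
      have := norm_sq_le_of_nonneg_form hPsymm (fun f => by rw [hPform]; linarith [hle f])
        (b := ‖P‖ + 1) (by positivity) (by linarith) (f n)
      rw [hPform, hf1, one_pow, mul_one] at this
      rwa [← hfs n]
    rw [tendsto_zero_iff_norm_tendsto_zero]
    have h3 := h2.sqrt
    simpa using h3
  obtain ⟨C, hC, hCK⟩ := hK.image_closedBall_subset_compact (f := K.toLinearMap) 1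
  obtain ⟨g, -, φ, hφ, hg⟩ := hC.tendsto_subseq (x := fun n => K (f n)) (fun n => hCK
    ⟨f n, by simp [hf1 n], rfl⟩)
  set A : H →L[ℂ] H := (l : ℂ) • (1 : H →L[ℂ] H) - G with hA
  have hAPK : ∀ x, A x = P x + K x := by
    intro x
    have : A x = (l : ℂ) • x - G x := rfl
    rw [this, hPapp, hBGK, add_apply]
    abel
  -- `(l - G) f = P f + K f`, where the first term tends to zero and the second converges along a
  -- subsequence. Inverting the closed embedding `l - G` makes the maximizing subsequence itself
  -- converge.
  have hAg : Tendsto (fun n => A (f (φ n))) atTop (𝓝 g) := by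
    have := (hPf.comp hφ.tendsto_atTop).add hg
    rw [zero_add] at this
    refine this.congr fun n => ?_
    simp [hAPK]
  have hemb := (antilipschitzWith_smul_one_sub hcl hG).isClosedEmbedding A.uniformContinuous
  obtain ⟨x, hx⟩ : g ∈ range A :=
    hemb.isClosed_range.mem_of_tendsto hAg (Eventually.of_forall fun n => ⟨_, rfl⟩)
  have hfx : Tendsto (fun n => f (φ n)) atTop (𝓝 x) := by
    rw [hemb.isEmbedding.tendsto_nhds_iff, hx]
    exact hAg
  refine ⟨x, ?_, ?_⟩
  · have h1 := hfx.norm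
    simp only [hf1] at h1
    have := tendsto_nhds_unique h1 tendsto_const_nhds
    exact norm_ne_zero_iff.mp (by rw [this]; norm_num)
  · have h1 : P x = 0 :=
      tendsto_nhds_unique ((P.continuous.tendsto x).comp hfx) (hPf.comp hφ.tendsto_atTop)
    rw [hPapp, sub_eq_zero] at h1
    exact h1.symm

/-- On the eigenspace `l - G` coincides with `K`. So the closed unit ball lies in the preimage of a
compact set under a closed embedding, and Riesz's theorem applies. -/
theorem finiteDimensional_eigenspace {B G K : H →L[ℂ] H}
    (hBGK : B = G + K) (hK : IsCompactOperator K) {c : ℝ}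
    (hG : ∀ f, (⟪G f, f⟫_ℂ).re ≤ c * ‖f‖ ^ 2) {l : ℝ} (hl : c < l) :
    FiniteDimensional ℂ (Module.End.eigenspace B.toLinearMap (l : ℂ)) := by
  have hlc : 0 < l - c := sub_pos.mpr hl
  set A : H →L[ℂ] H := (l : ℂ) • (1 : H →L[ℂ] H) - G with hA
  have hemb := (antilipschitzWith_smul_one_sub hl hG).isClosedEmbedding A.uniformContinuous
  obtain ⟨C, hC, hCK⟩ := hK.image_closedBall_subset_compact (f := K.toLinearMap) 1
  set E := Module.End.eigenspace B.toLinearMap (l : ℂ) with hE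
  have hEmem : ∀ x, x ∈ E ↔ B x = (l : ℂ) • x := fun x => Module.End.mem_eigenspace_iff
  have hEcl : IsClosed (E : Set H) := by
    have : (E : Set H) = {x | B x = (l : ℂ) • x} := by
      ext x
      exact hEmem x
    rw [this]
    exact isClosed_eq B.continuous (continuous_const_smul _)
  have hE' : IsClosedEmbedding ((↑) : E → H) := hEcl.isClosedEmbedding_subtypeVal
  have hcomp := hE'.isCompact_preimage (hemb.isCompact_preimage hC)
  refine FiniteDimensional.of_isCompact_closedBall₀ ℂ (r := 1) one_pos
    (hcomp.of_isClosed_subset Metric.isClosed_closedBall ?_)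
  intro x hx
  have hAx : A x = K x := by
    have h1 : A x = (l : ℂ) • (x : H) - G x := rfl
    rw [h1, ← (hEmem x).mp x.2, hBGK, add_apply]
    abel
  change A x ∈ C
  rw [hAx]
  exact hCK ⟨x, by simpa using hx, rfl⟩

/-- If `B = G + K` is symmetric with `G ≤ c` and `K` compact, and if the form of `B - c` is
positive on an infinite sequence that is orthogonal both for the form and for the inner product,
then `B` has infinitely many eigenvalues above `c`. -/
theorem infinite_setOf_eigenvalue_gt {B G K : H →L[ℂ] H} (hB : B.toLinearMap.IsSymmetric)
    (hBGK : B = G + K) (hK : IsCompactOperator K) {c : ℝ} (hc : 0 ≤ c)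
    (hG : ∀ f, (⟪G f, f⟫_ℂ).re ≤ c * ‖f‖ ^ 2) {g : ℕ → H}
    (hBg : ∀ n m, n ≠ m → ⟪B (g n), g m⟫_ℂ = 0) (hg : ∀ n m, n ≠ m → ⟪g n, g m⟫_ℂ = 0)
    (hpos : ∀ n, c * ‖g n‖ ^ 2 < (⟪B (g n), g n⟫_ℂ).re) :
    {l : ℝ | c < l ∧ ∃ f : H, f ≠ 0 ∧ B f = (l : ℂ) • f}.Infinite := by
  intro hfin
  set S := hfin.toFinset with hS
  set E : Submodule ℂ H := S.sup fun l : ℝ => Module.End.eigenspace B.toLinearMap (l : ℂ) with hE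
  have hEsub : ∀ l ∈ S, Module.End.eigenspace B.toLinearMap (l : ℂ) ≤ E := fun l hl =>
    Finset.le_sup (f := fun l : ℝ => Module.End.eigenspace B.toLinearMap (l : ℂ)) hl
  have hEfin : FiniteDimensional ℂ E := by
    have hlS : ∀ l ∈ S, FiniteDimensional ℂ (Module.End.eigenspace B.toLinearMap (l : ℂ)) :=
      fun l hl => finiteDimensional_eigenspace hBGK hK hG (hfin.mem_toFinset.mp hl).1
    rw [hE, Finset.sup_eq_iSup, iSup_subtype']
    have : ∀ l : {l // l ∈ S},
        FiniteDimensional ℂ (Module.End.eigenspace B.toLinearMap ((l : ℝ) : ℂ)) :=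
      fun l => hlS l l.2
    infer_instance
  have hEinv : E ≤ E.comap B.toLinearMap := by
    refine Finset.sup_le fun l hl x hx => ?_
    rw [Submodule.mem_comap, Module.End.mem_eigenspace_iff.mp hx]
    exact E.smul_mem _ (hEsub l hl hx)
  have hFinv : ∀ x ∈ Eᗮ, B x ∈ Eᗮ := by
    intro x hx
    rw [Submodule.mem_orthogonal] at hx ⊢
    intro e he
    have h1 : ⟪B e, x⟫_ℂ = ⟪e, B x⟫_ℂ := hB e x
    rw [← h1]
    exact hx _ (hEinv he)
  obtain ⟨h, hhE, hh⟩ := exists_mem_orthogonal_form_gt E hBg hg hpos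
  -- If there were finitely many such eigenvalues, their eigenspaces would span the
  -- finite-dimensional invariant `E`. Compressing to `Eᗮ` preserves all hypotheses (the bound on
  -- `G` since `c ≥ 0`) and yields one more eigenvector.
  set Q : H →L[ℂ] H := Eᗮ.starProjection with hQ
  have hQsymm : ∀ x y, ⟪Q x, y⟫_ℂ = ⟪x, Q y⟫_ℂ := fun x y =>
    Submodule.starProjection_isSymmetric _ x y
  have hQmem : ∀ x, Q x ∈ Eᗮ := fun x => Submodule.starProjection_apply_mem _ x
  have hQid : ∀ x ∈ Eᗮ, Q x = x := fun x hx => Submodule.starProjection_eq_self_iff.mpr hx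
  have hQnorm : ∀ x, ‖Q x‖ ≤ ‖x‖ := fun x => Submodule.norm_starProjection_apply_le _ x
  obtain ⟨l, hcl, f, hf0, hf⟩ := exists_eigenvalue_gt (B := Q ∘L B ∘L Q) (G := Q ∘L G ∘L Q)
    (K := Q ∘L K ∘L Q) (c := c) (h := h) (by
      intro x y
      have h1 : ⟪B (Q x), Q y⟫_ℂ = ⟪Q x, B (Q y)⟫_ℂ := hB _ _
      simp only [ContinuousLinearMap.coe_coe, ContinuousLinearMap.comp_apply]
      rw [hQsymm, h1, hQsymm]) (by rw [hBGK]; ext x; simp)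
    ((hK.comp_clm Q).clm_comp Q) (by
      intro x
      simp only [ContinuousLinearMap.comp_apply]
      rw [hQsymm]
      refine (hG _).trans ?_
      gcongr
      exact hQnorm x) (by
      simp only [ContinuousLinearMap.comp_apply]
      rwa [hQsymm, hQid h hhE])
  -- A nonzero eigenvalue forces the eigenvector into the range of `Q`, where the compression acts
  -- as `B`.
  have hl0 : (l : ℂ) ≠ 0 := Complex.ofReal_ne_zero.mpr (hc.trans_lt hcl).ne'
  have hfE : f ∈ Eᗮ := by
    have h1 : (l : ℂ) • f ∈ Eᗮ := by
      rw [← hf]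
      exact hQmem _
    exact (Submodule.smul_mem_iff _ hl0).mp h1
  have hBf : B f = (l : ℂ) • f := by
    rw [← hf]
    simp only [ContinuousLinearMap.comp_apply]
    rw [hQid f hfE, hQid _ (hFinv f hfE)]
  have hlS : l ∈ S := hfin.mem_toFinset.mpr ⟨hcl, f, hf0, hBf⟩
  have hfE' : f ∈ E := hEsub l hlS (Module.End.mem_eigenspace_iff.mpr hBf)
  exact hf0 (by simpa using (Submodule.mem_orthogonal _ _).mp hfE f hfE')

/-- Let `G ≤ c` and `U` be self-adjoint with `U G` compact and `‖G U‖ < 1`. If `G` is thought of as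
`(A + M)⁻¹`, this theorem counts the eigenvalues of the resolvent of `A - U` at `-M` above `c`. -/
theorem infinite_setOf_perturbed_eigenvalue {G U : H →L[ℂ] H} (hGs : IsSelfAdjoint G)
    (hUs : IsSelfAdjoint U) (hGU : ‖G * U‖ < 1) (hUG : IsCompactOperator (U * G))
    {c : ℝ} (hc : 0 ≤ c) (hG : ∀ f, (⟪G f, f⟫_ℂ).re ≤ c * ‖f‖ ^ 2) {f h : ℕ → H}
    (hfh : ∀ n, f n = G (h n + U (f n))) (h₁ : ∀ n m, n ≠ m → ⟪f n, h m⟫_ℂ = 0)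
    (h₂ : ∀ n m, n ≠ m → ⟪h n, h m⟫_ℂ = 0)
    (hpos : ∀ n, c * ‖h n‖ ^ 2 < (⟪f n, h n⟫_ℂ).re) :
    {l : ℝ | c < l ∧ ∃ ψ : H, ψ ≠ 0 ∧ (l : ℂ) • ψ = G (ψ + (l : ℂ) • U ψ)}.Infinite := by
  have hunit : IsUnit (1 - G * U) := isUnit_one_sub_of_norm_lt_one hGU
  have hstar : star (1 - G * U) = 1 - U * G := by
    rw [star_sub, star_one, star_mul, hGs.star_eq, hUs.star_eq]
  have hunit' : IsUnit (1 - U * G) := by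
    rw [← hstar]
    exact hunit.star
  set R := Ring.inverse (1 - G * U)
  have hR₁ : (1 - G * U) * R = 1 := Ring.mul_inverse_cancel _ hunit
  have hR₂ : R * (1 - G * U) = 1 := Ring.inverse_mul_cancel _ hunit
  -- `T = (1 - G U)⁻¹ G` plays the role of the resolvent of `A - U` at `-M`, given by a Neumann
  -- series.
  set T := R * G
  have hT₁ : (1 - G * U) * T = G := by rw [← mul_assoc, hR₁, one_mul]
  have hT₂ : T * (1 - U * G) = G := by
    have : G * (1 - U * G) = (1 - G * U) * G := by
      rw [mul_sub, sub_mul, mul_one, one_mul, mul_assoc]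
    rw [mul_assoc, this, ← mul_assoc, hR₂, one_mul]
  have hTs : IsSelfAdjoint T := by
    refine hunit'.mul_right_cancel ?_
    rw [hT₂, star_mul, hGs.star_eq, ← hstar, mul_assoc, ← star_mul, hR₁, star_one, mul_one]
  have hTf : ∀ n, T (h n) = f n := by
    intro n
    have e : (1 - G * U) (f n) = G (h n) := by
      have e₁ : (1 - G * U) (f n) = f n - G (U (f n)) := rfl
      rw [e₁, sub_eq_iff_eq_add, ← map_add]
      exact hfh n
    calc T (h n) = R (G (h n)) := rfl
      _ = (R * (1 - G * U)) (f n) := by rw [← e]; rfl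
      _ = f n := by rw [hR₂]; rfl
  -- The second resolvent identity exhibits `T` as a compact perturbation of `G`.
  have hTGK : T = G + T * (U * G) := by
    rw [mul_sub, mul_one, sub_eq_iff_eq_add] at hT₂
    exact hT₂
  refine (infinite_setOf_eigenvalue_gt (B := T) (K := T * (U * G)) (g := h)
    (ContinuousLinearMap.isSelfAdjoint_iff_isSymmetric.mp hTs) hTGK (hUG.clm_comp T) hc hG
    (fun n m hnm => by rw [hTf]; exact h₁ n m hnm) h₂ (fun n => by rw [hTf]; exact hpos n)).mono ?_
  rintro l ⟨hl, ψ, hψ, hTψ⟩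
  refine ⟨hl, ψ, hψ, ?_⟩
  have e : T ψ - G (U (T ψ)) = G ψ := congrArg (fun A : H →L[ℂ] H => A ψ) hT₁
  rw [hTψ, sub_eq_iff_eq_add, ← map_add, map_smul] at e
  exact e

end Spectral

/-! ### Compactness of operators with square integrable kernels. -/

section HilbertSchmidt

variable {H α : Type*} [NormedAddCommGroup H] [NormedSpace ℂ H] [MeasurableSpace α]
  {μ : Measure α}

/-- The operator `g ↦ (x ↦ k x g)` with values in `L²` that is defined by a square integrable
family `k` of functionals. -/
def kernelOp (μ : Measure α) : Lp (H →L[ℂ] ℂ) 2 μ →L[ℂ] H →L[ℂ] Lp ℂ 2 μ :=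
  LinearMap.mkContinuous₂
    (LinearMap.mk₂ ℂ (fun k g => (ContinuousLinearMap.apply ℂ ℂ g).compLp k)
      (fun k k' g => by exact map_add ((ContinuousLinearMap.apply ℂ ℂ g).compLpₗ 2 μ) k k')
      (fun c k g => by exact map_smul ((ContinuousLinearMap.apply ℂ ℂ g).compLpₗ 2 μ) c k)
      (fun k g g' => by rw [map_add, ContinuousLinearMap.add_compLp])
      (fun c k g => by rw [map_smul, ContinuousLinearMap.smul_compLp])) 1
    (fun k g => by
      change ‖(ContinuousLinearMap.apply ℂ ℂ g).compLp k‖ ≤ _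
      refine (ContinuousLinearMap.norm_compLp_le _ _).trans ?_
      rw [one_mul, mul_comm]
      gcongr
      refine ContinuousLinearMap.opNorm_le_bound _ (norm_nonneg _) fun k => ?_
      rw [ContinuousLinearMap.apply_apply, mul_comm]
      exact k.le_opNorm g)

theorem kernelOp_apply (k : Lp (H →L[ℂ] ℂ) 2 μ) (g : H) :
    kernelOp μ k g =ᵐ[μ] fun x => k x g :=
  ContinuousLinearMap.coeFn_compLp _ _

/-- An indicator times a constant functional gives a rank-one operator at most. Sums and limits
follow because `kernelOp` is continuous and compact operators are closed in norm. -/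
theorem isCompactOperator_kernelOp (k : Lp (H →L[ℂ] ℂ) 2 μ) :
    IsCompactOperator (kernelOp μ k) := by
  refine Lp.induction (by norm_num) (fun k => IsCompactOperator (kernelOp μ k)) ?_ ?_ ?_ k
  · intro c s hs hμs
    have h : kernelOp μ (indicatorConstLp 2 hs hμs.ne c) =
        (ContinuousLinearMap.toSpanSingleton ℂ (indicatorConstLp 2 hs hμs.ne (1 : ℂ))) ∘L c := by
      ext1 g
      apply Lp.ext
      filter_upwards [kernelOp_apply (indicatorConstLp 2 hs hμs.ne c) g,
        indicatorConstLp_coeFn (p := 2) (hs := hs) (hμs := hμs.ne) (c := c),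
        indicatorConstLp_coeFn (p := 2) (hs := hs) (hμs := hμs.ne) (c := (1 : ℂ)),
        Lp.coeFn_smul (c g) (indicatorConstLp 2 hs hμs.ne (1 : ℂ))] with x h1 h2 h3 h4
      rw [h1, h2, ContinuousLinearMap.comp_apply, ContinuousLinearMap.toSpanSingleton_apply, h4,
        Pi.smul_apply, h3]
      by_cases hx : x ∈ s <;> simp [hx]
    rw [Lp.simpleFunc.coe_indicatorConst, h]
    exact (isCompactOperator_of_locallyCompactSpace_dom c).clm_comp
      (ContinuousLinearMap.toSpanSingleton ℂ (indicatorConstLp 2 hs hμs.ne (1 : ℂ)))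
  · intro f g hf hg _ h1 h2
    rw [map_add]
    exact h1.add h2
  · exact isClosed_setOfPred_isCompactOperator.preimage (kernelOp μ).continuous

end HilbertSchmidt

/-! ### Bounded multiplication operators on `L²`. -/

section Multiplication

variable {d : ℕ}

/-- The operator of multiplication by an element of `L^∞` on `L²`. -/
def mulLp (d : ℕ) : Lp ℂ ∞ (volume : Measure (Space d)) →L[ℂ] L2 d →L[ℂ] L2 d :=
  (ContinuousLinearMap.mul ℂ ℂ).holderL volume ∞ 2 2

theorem coeFn_mulLp (w : Lp ℂ ∞ (volume : Measure (Space d))) (f : L2 d) :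
    mulLp d w f =ᵐ[volume] fun x => w x * f x :=
  (ContinuousLinearMap.mul ℂ ℂ).coeFn_holder w f

theorem norm_mulLp_le (w : Lp ℂ ∞ (volume : Measure (Space d))) : ‖mulLp d w‖ ≤ ‖w‖ := by
  refine ContinuousLinearMap.opNorm_le_bound _ (norm_nonneg _) fun f => ?_
  refine ((ContinuousLinearMap.mul ℂ ℂ).norm_holder_apply_apply_le w f).trans ?_
  rw [ContinuousLinearMap.opNorm_mul, one_mul]

theorem isSelfAdjoint_mulLp {w : Lp ℂ ∞ (volume : Measure (Space d))}
    (hw : ∀ᵐ x, (w x).im = 0) : IsSelfAdjoint (mulLp d w) := by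
  rw [ContinuousLinearMap.isSelfAdjoint_iff_isSymmetric]
  intro f g
  rw [L2.inner_def, L2.inner_def]
  refine integral_congr_ae ?_
  filter_upwards [hw, coeFn_mulLp w f, coeFn_mulLp w g] with x h1 h2 h3
  simp only [ContinuousLinearMap.coe_coe, h2, h3, RCLike.inner_apply, map_mul,
    Complex.conj_eq_iff_im.mpr h1]
  ring

end Multiplication

/-! ### The `L²` Fourier transform as an integral on `L¹ ∩ L²`. -/

section Fourier

open FourierTransform

variable {d : ℕ}

/-- On `L¹ ∩ L²`, the inverse Fourier transform is given by the Fourier integral. -/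
theorem coeFn_fourierInv_of_integrable (h : L2 d) (hh : Integrable h volume) :
    (𝓕⁻ h : L2 d) =ᵐ[volume] 𝓕⁻ (h : Space d → ℂ) := by
  have hcont : Continuous (𝓕⁻ (h : Space d → ℂ)) :=
    VectorFourier.fourierIntegral_continuous Real.continuous_fourierChar
      (L := -innerₗ (Space d)) (by
        simp only [LinearMap.neg_apply, innerₗ_apply_apply]
        fun_prop) hh
  refine ae_eq_of_integral_contDiff_smul_eq ((Lp.memLp _).locallyIntegrable (by norm_num))
    hcont.locallyIntegrable fun φ hφ hφc => ?_
  have hg₁ : HasCompactSupport (Complex.ofRealCLM ∘ φ) := hφc.comp_left rfl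
  have hg₂ : ContDiff ℝ (⊤ : ℕ∞) (Complex.ofRealCLM ∘ φ) :=
    Complex.ofRealCLM.contDiff.comp hφ
  set ψ : 𝓢(Space d, ℂ) := hg₁.toSchwartzMap hg₂ with hψ
  have hψa : ∀ x, ψ x = (φ x : ℂ) := fun x => rfl
  -- Test both sides against a smooth compactly supported function, moving the transform onto it:
  -- once by the distributional definition, once by Fubini.
  calc ∫ x, φ x • (𝓕⁻ h : L2 d) x = ∫ x, ψ x • (𝓕⁻ h : L2 d) x := by
        simp [hψa]
    _ = ((𝓕⁻ h : L2 d) : 𝓢'(Space d, ℂ)) ψ := by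
        rw [Lp.toTemperedDistribution_apply]
    _ = ∫ x, (𝓕⁻ ψ) x • h x := by
        rw [← Lp.fourierInv_toTemperedDistribution_eq, TemperedDistribution.fourierInv_apply,
          Lp.toTemperedDistribution_apply]
    _ = ∫ x, (𝓕⁻ (ψ : Space d → ℂ)) x • h x := by
        rw [← SchwartzMap.fourierInv_coe]
    _ = ∫ x, ψ x • 𝓕⁻ (h : Space d → ℂ) x := by
        have := VectorFourier.integral_fourierIntegral_smul_eq_flip (μ := volume) (ν := volume)
          (L := -innerₗ (Space d)) Real.continuous_fourierChar (by
            simp only [LinearMap.neg_apply, innerₗ_apply_apply]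
            fun_prop) ψ.integrable hh
        have hflip : (-innerₗ (Space d)).flip = -innerₗ (Space d) := by
          ext x y
          simp [real_inner_comm]
        rw [hflip] at this
        exact this
    _ = _ := by simp [hψa]

end Fourier

/-! ### Compactness of `w(x) 𝓕⁻¹ m(ξ)` for symbols vanishing at infinity. -/

section Compactness

open FourierTransform
open scoped RealInnerProductSpace

variable {d : ℕ}

theorem norm_le_of_ae_bound_top {w : Lp ℂ ∞ (volume : Measure (Space d))} {C : ℝ} (hC : 0 ≤ C)
    (h : ∀ᵐ x, ‖w x‖ ≤ C) : ‖w‖ ≤ C := by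
  rw [Lp.norm_def, eLpNorm_exponent_top]
  exact ENNReal.toReal_le_of_le_ofReal hC (eLpNormEssSup_le_of_ae_bound h)

theorem norm_fourierChar_sub_le (a b : ℝ) :
    ‖(Real.fourierChar a : ℂ) - Real.fourierChar b‖ ≤ 2 * Real.pi * |a - b| := by
  have h : (Real.fourierChar a : ℂ) = Real.fourierChar (a - b) * Real.fourierChar b := by
    rw [← Circle.coe_mul, ← AddChar.map_add_eq_mul, sub_add_cancel]
  rw [h, ← sub_one_mul, norm_mul, Circle.norm_coe, mul_one, Real.fourierChar_apply, mul_comm]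
  refine Real.norm_exp_I_mul_ofReal_sub_one_le.trans ?_
  rw [Real.norm_eq_abs, abs_mul, abs_of_pos Real.two_pi_pos]

theorem memLp_two_of_bounded_support {w : Lp ℂ ∞ (volume : Measure (Space d))} {R : ℝ}
    (hw : ∀ᵐ x, R < ‖x‖ → w x = 0) : MemLp w 2 volume := by
  have h : (w : Space d → ℂ) =ᵐ[volume] (Metric.closedBall 0 R).indicator w := by
    filter_upwards [hw] with x hx
    by_cases h : x ∈ Metric.closedBall 0 R
    · rw [indicator_of_mem h]
    · rw [indicator_of_notMem h]
      exact hx (by simpa using h)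
  rw [memLp_congr_ae h, memLp_indicator_iff_restrict Metric.isClosed_closedBall.measurableSet]
  have : IsFiniteMeasure (volume.restrict (Metric.closedBall (0 : Space d) R)) :=
    ⟨by simpa using measure_closedBall_lt_top⟩
  exact ((Lp.memLp w).restrict _).mono_exponent (by simp)

theorem memLp_fourierChar_mul {m : Space d → ℂ} (hm : MemLp m 2 volume) (x : Space d) :
    MemLp (fun ξ => (Real.fourierChar ⟪ξ, x⟫ : ℂ) * m ξ) 2 volume := by
  refine hm.of_le (AEStronglyMeasurable.mul ?_ hm.1) (Eventually.of_forall fun ξ => ?_)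
  · refine Continuous.aestronglyMeasurable ?_
    exact continuous_subtype_val.comp (Real.continuous_fourierChar.comp (by fun_prop))
  · rw [norm_mul, Circle.norm_coe, one_mul]

theorem continuous_toLp_fourierChar_mul {m : Space d → ℂ} (hm : MemLp m 2 volume) {R : ℝ}
    (hR : 0 ≤ R) (hmR : ∀ᵐ x, R < ‖x‖ → m x = 0) :
    Continuous fun x => (memLp_fourierChar_mul hm x).toLp := by
  refine LipschitzWith.continuous (K := ⟨2 * Real.pi * R * ‖hm.toLp‖, by positivity⟩)
    (LipschitzWith.of_dist_le_mul fun x y => ?_)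
  rw [dist_eq_norm, dist_eq_norm]
  change _ ≤ 2 * Real.pi * R * ‖hm.toLp‖ * ‖x - y‖
  have : ‖(memLp_fourierChar_mul hm x).toLp - (memLp_fourierChar_mul hm y).toLp‖ ≤
      (2 * Real.pi * (R * ‖x - y‖)) * ‖hm.toLp‖ := by
    refine Lp.norm_le_mul_norm_of_ae_le_mul ?_
    filter_upwards [Lp.coeFn_sub (memLp_fourierChar_mul hm x).toLp
      (memLp_fourierChar_mul hm y).toLp, (memLp_fourierChar_mul hm x).coeFn_toLp,
      (memLp_fourierChar_mul hm y).coeFn_toLp, hm.coeFn_toLp, hmR] with ξ h1 h2 h3 h4 h5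
    rw [h1, Pi.sub_apply, h2, h3, h4, ← sub_mul, norm_mul]
    by_cases hξ : R < ‖ξ‖
    · rw [h5 hξ]
      simp
    · gcongr
      refine (norm_fourierChar_sub_le _ _).trans ?_
      gcongr
      rw [← inner_sub_right]
      refine (abs_real_inner_le_norm _ _).trans ?_
      gcongr
      exact not_lt.mp hξ
  linarith

/-- The operator has kernel `w(x) e(⟨ξ, x⟩) m(ξ)`. As a functional of `g` it is continuous and
bounded in `x` apart from the factor `w ∈ L²`, hence a square integrable family. -/
theorem isCompactOperator_mul_fourierInv_mul_of_bounded_support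
    {w m : Lp ℂ ∞ (volume : Measure (Space d))} {R : ℝ} (hR : 0 ≤ R)
    (hw : ∀ᵐ x, R < ‖x‖ → w x = 0) (hm : ∀ᵐ x, R < ‖x‖ → m x = 0) :
    IsCompactOperator (mulLp d w ∘L fourierInvCLM ℂ (L2 d) ∘L mulLp d m) := by
  have hm2 := memLp_two_of_bounded_support hm
  have hw2 := memLp_two_of_bounded_support hw
  let B := (ContinuousLinearMap.mul ℂ ℂ).lpPairing (volume : Measure (Space d)) 2 2
  let κ : Space d → (L2 d →L[ℂ] ℂ) := fun x => B (memLp_fourierChar_mul hm2 x).toLp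
  have hκ : Continuous κ := B.continuous.comp (continuous_toLp_fourierChar_mul hm2 hR hm)
  have hκb : ∀ x, ‖κ x‖ ≤ ‖B‖ * ‖hm2.toLp‖ := by
    intro x
    refine (B.le_opNorm _).trans ?_
    gcongr
    refine Lp.norm_le_norm_of_ae_le ?_
    filter_upwards [(memLp_fourierChar_mul hm2 x).coeFn_toLp, hm2.coeFn_toLp] with ξ h1 h2
    rw [h1, h2, norm_mul, Circle.norm_coe, one_mul]
  have hk : MemLp (fun x => w x • κ x) 2 volume := by
    refine MemLp.of_le_mul (c := ‖B‖ * ‖hm2.toLp‖) hw2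
      (hw2.1.smul hκ.aestronglyMeasurable) (Eventually.of_forall fun x => ?_)
    rw [norm_smul, mul_comm]
    gcongr
    exact hκb x
  have hop : mulLp d w ∘L fourierInvCLM ℂ (L2 d) ∘L mulLp d m = kernelOp volume hk.toLp := by
    ext1 g
    apply Lp.ext
    have hint : Integrable (mulLp d m g) volume :=
      (MemLp.integrable_mul hm2 (Lp.memLp g)).congr (coeFn_mulLp m g).symm
    filter_upwards [kernelOp_apply hk.toLp g, hk.coeFn_toLp,
      coeFn_mulLp w (𝓕⁻ (mulLp d m g) : L2 d), coeFn_fourierInv_of_integrable _ hint]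
      with x h1 h2 h3 h4
    rw [h1, h2]
    change (mulLp d w (𝓕⁻ (mulLp d m g) : L2 d)) x = w x * κ x g
    rw [h3, h4]
    congr 1
    rw [Real.fourierInv_eq, ContinuousLinearMap.lpPairing_eq_integral]
    refine integral_congr_ae ?_
    filter_upwards [coeFn_mulLp m g, (memLp_fourierChar_mul hm2 x).coeFn_toLp] with ξ h5 h6
    rw [h5, h6, ContinuousLinearMap.mul_apply', Circle.smul_def, smul_eq_mul, mul_assoc]
  rw [hop]
  exact isCompactOperator_kernelOp _

/-- `w` tends to zero at infinity, up to null sets. -/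
def VanishesAtInfinity (w : Space d → ℂ) : Prop :=
  ∀ ε : ℝ, 0 < ε → ∃ R : ℝ, ∀ᵐ x, R < ‖x‖ → ‖w x‖ ≤ ε

/-- The truncation of `w` to the ball of radius `n`. -/
def truncate (w : Lp ℂ ∞ (volume : Measure (Space d))) (n : ℕ) :
    Lp ℂ ∞ (volume : Measure (Space d)) :=
  ((Lp.memLp w).indicator
    (Metric.isClosed_closedBall (x := (0 : Space d)) (ε := (n : ℝ))).measurableSet).toLp

theorem truncate_apply (w : Lp ℂ ∞ (volume : Measure (Space d))) (n : ℕ) :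
    ∀ᵐ x, truncate w n x = if ‖x‖ ≤ n then w x else 0 := by
  classical
  filter_upwards [((Lp.memLp w).indicator
    (Metric.isClosed_closedBall (x := (0 : Space d)) (ε := (n : ℝ))).measurableSet).coeFn_toLp]
    with x hx
  rw [truncate, hx, indicator_apply]
  simp

theorem tendsto_truncate {w : Lp ℂ ∞ (volume : Measure (Space d))} (hw : VanishesAtInfinity w) :
    Tendsto (truncate w) atTop (𝓝 w) := by
  rw [Metric.tendsto_atTop']
  intro ε hε
  obtain ⟨R, hR⟩ := hw (ε / 2) (by positivity)
  obtain ⟨N, hN⟩ := exists_nat_gt R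
  refine ⟨N, fun n hn => ?_⟩
  rw [dist_eq_norm]
  refine lt_of_le_of_lt (norm_le_of_ae_bound_top (C := ε / 2) (by positivity) ?_) (by linarith)
  filter_upwards [hR, truncate_apply w n, Lp.coeFn_sub (truncate w n) w] with x h1 h2 h3
  rw [h3, Pi.sub_apply, h2]
  split_ifs with h
  · rw [sub_self, norm_zero]
    positivity
  · rw [zero_sub, norm_neg]
    refine h1 (hN.trans_le ?_)
    have : (N : ℝ) ≤ n := by exact_mod_cast hn.le
    linarith [not_le.mp h]

theorem continuous_mul_fourierInv_mul :
    Continuous fun p : Lp ℂ ∞ (volume : Measure (Space d)) × Lp ℂ ∞ (volume : Measure (Space d)) =>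
      mulLp d p.1 ∘L fourierInvCLM ℂ (L2 d) ∘L mulLp d p.2 :=
  ((mulLp d).continuous.comp continuous_fst).clm_comp
    (((mulLp d).continuous.comp continuous_snd).const_clm_comp (fourierInvCLM ℂ (L2 d)))

/-- Truncating both symbols to balls converges in `L^∞`, hence in operator norm. -/
theorem isCompactOperator_mul_fourierInv_mul {w m : Lp ℂ ∞ (volume : Measure (Space d))}
    (hw : VanishesAtInfinity w) (hm : VanishesAtInfinity m) :
    IsCompactOperator (mulLp d w ∘L fourierInvCLM ℂ (L2 d) ∘L mulLp d m) := by
  have htr : ∀ (v : Lp ℂ ∞ (volume : Measure (Space d))) (n : ℕ),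
      ∀ᵐ x, (n : ℝ) < ‖x‖ → truncate v n x = 0 := by
    intro v n
    filter_upwards [truncate_apply v n] with x hx h
    rw [hx, if_neg (not_le.mpr h)]
  have ht := (continuous_mul_fourierInv_mul.tendsto (w, m)).comp
    ((tendsto_truncate hw).prodMk_nhds (tendsto_truncate hm))
  exact isCompactOperator_of_tendsto ht (Eventually.of_forall fun n =>
    isCompactOperator_mul_fourierInv_mul_of_bounded_support n.cast_nonneg (htr w n) (htr m n))

end Compactness

/-! ### The free resolvent as a Fourier multiplier. -/

section Resolvent

open FourierTransform
open scoped InnerProductSpace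

variable {d : ℕ}

/-- The symbol of the resolvent of `-Δ` at `-M`. -/
def resolventSymbol {d : ℕ} (M : ℝ) (ξ : Space d) : ℂ :=
  ((M + (2 * Real.pi) ^ 2 * ‖ξ‖ ^ 2)⁻¹ : ℝ)

theorem le_symbol (M : ℝ) (ξ : Space d) : M ≤ M + (2 * Real.pi) ^ 2 * ‖ξ‖ ^ 2 := by
  have : 0 ≤ (2 * Real.pi) ^ 2 * ‖ξ‖ ^ 2 := by positivity
  linarith

theorem norm_resolventSymbol_le {M : ℝ} (hM : 0 < M) (ξ : Space d) :
    ‖resolventSymbol M ξ‖ ≤ M⁻¹ := by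
  rw [resolventSymbol, Complex.norm_real, Real.norm_eq_abs,
    abs_of_nonneg (inv_nonneg.mpr (hM.le.trans (le_symbol M ξ)))]
  exact inv_anti₀ hM (le_symbol M ξ)

theorem resolventSymbol_mul {M : ℝ} (hM : 0 < M) (ξ : Space d) :
    resolventSymbol M ξ * (M + (2 * Real.pi) ^ 2 * ‖ξ‖ ^ 2 : ℂ) = 1 := by
  have := inv_mul_cancel₀ (hM.trans_le (le_symbol M ξ)).ne'
  rw [resolventSymbol]
  exact_mod_cast this

theorem memLp_resolventSymbol {M : ℝ} (hM : 0 < M) :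
    MemLp (resolventSymbol (d := d) M) ∞ volume := by
  refine memLp_top_of_bound (Continuous.aestronglyMeasurable ?_) M⁻¹
    (Eventually.of_forall (norm_resolventSymbol_le hM))
  refine Complex.continuous_ofReal.comp (Continuous.inv₀ (by fun_prop) fun ξ => ?_)
  exact (hM.trans_le (le_symbol M ξ)).ne'

/-- The resolvent `(-Δ + M)⁻¹` on `L²`. -/
def freeResolvent (d : ℕ) {M : ℝ} (hM : 0 < M) : L2 d →L[ℂ] L2 d :=
  fourierInvCLM ℂ (L2 d) ∘L mulLp d (memLp_resolventSymbol hM).toLp ∘L fourierCLM ℂ (L2 d)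

theorem freeResolvent_apply {M : ℝ} (hM : 0 < M) (f : L2 d) :
    freeResolvent d hM f = 𝓕⁻ (mulLp d (memLp_resolventSymbol hM).toLp (𝓕 f)) := rfl

theorem norm_freeResolvent_le {M : ℝ} (hM : 0 < M) : ‖freeResolvent d hM‖ ≤ M⁻¹ := by
  refine ContinuousLinearMap.opNorm_le_bound _ (inv_nonneg.mpr hM.le) fun f => ?_
  have h1 : ∀ g : L2 d, ‖(𝓕⁻ g : L2 d)‖ = ‖g‖ := fun g => by
    rw [← Lp.norm_fourier_eq, fourier_fourierInv_eq]
  rw [freeResolvent_apply, h1, ← Lp.norm_fourier_eq f]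
  refine ContinuousLinearMap.le_of_opNorm_le _ ((norm_mulLp_le _).trans ?_) _
  refine norm_le_of_ae_bound_top (inv_nonneg.mpr hM.le) ?_
  filter_upwards [(memLp_resolventSymbol (d := d) hM).coeFn_toLp] with ξ h
  rw [h]
  exact norm_resolventSymbol_le hM ξ

theorem isSelfAdjoint_freeResolvent {M : ℝ} (hM : 0 < M) :
    IsSelfAdjoint (freeResolvent d hM) := by
  have hs : IsSelfAdjoint (mulLp d (memLp_resolventSymbol hM).toLp) := by
    refine isSelfAdjoint_mulLp ?_
    filter_upwards [(memLp_resolventSymbol (d := d) hM).coeFn_toLp] with ξ h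
    rw [h, resolventSymbol, Complex.ofReal_im]
  rw [ContinuousLinearMap.isSelfAdjoint_iff_isSymmetric] at hs ⊢
  intro f g
  simp only [ContinuousLinearMap.coe_coe, freeResolvent_apply]
  rw [← Lp.inner_fourier_eq, fourier_fourierInv_eq,
    ← Lp.inner_fourier_eq f, fourier_fourierInv_eq]
  exact hs _ _

theorem isCompactOperator_mul_freeResolvent {M : ℝ} (hM : 0 < M)
    {w : Lp ℂ ∞ (volume : Measure (Space d))} (hw : VanishesAtInfinity w) :
    IsCompactOperator (mulLp d w * freeResolvent d hM) := by
  have hm : VanishesAtInfinity ((memLp_resolventSymbol (d := d) hM).toLp) := by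
    intro ε hε
    -- The extra `1` ensures `‖ξ‖ ≤ ‖ξ‖ ^ 2`.
    refine ⟨ε⁻¹ + 1, ?_⟩
    filter_upwards [(memLp_resolventSymbol (d := d) hM).coeFn_toLp] with ξ h hξ
    have hε' : 0 < ε⁻¹ := inv_pos.mpr hε
    have h1 : ε⁻¹ ≤ M + (2 * Real.pi) ^ 2 * ‖ξ‖ ^ 2 := by
      have h2 : 1 ≤ (2 * Real.pi) ^ 2 := by
        have := Real.pi_gt_three
        nlinarith
      nlinarith [sq_nonneg ‖ξ‖]
    rw [h, resolventSymbol, Complex.norm_real, Real.norm_eq_abs,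
      abs_of_nonneg (inv_nonneg.mpr (hε'.le.trans h1))]
    exact (inv_anti₀ hε' h1).trans (inv_inv ε).le
  exact (isCompactOperator_mul_fourierInv_mul hw hm).comp_clm (fourierCLM ℂ (L2 d))

theorem hasTemperateGrowth_norm_sq :
    (fun ξ : Space d => Complex.ofReal (‖ξ‖ ^ 2)).HasTemperateGrowth := by
  fun_prop

/-- `u = (-Δ + M)⁻¹ f` satisfies `M u - Δ u = f` in the sense of distributions. -/
theorem laplacian_freeResolvent {M : ℝ} (hM : 0 < M) (f : L2 d) :
    Δ ((freeResolvent d hM f : L2 d) : 𝓢'(Space d, ℂ)) =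
      ((M : ℂ) • freeResolvent d hM f - f : L2 d) := by
  set g := mulLp d (memLp_resolventSymbol hM).toLp (𝓕 f) with hg
  have h1 : 𝓕 ((freeResolvent d hM f : L2 d) : 𝓢'(Space d, ℂ)) = (g : 𝓢'(Space d, ℂ)) := by
    rw [Lp.fourier_toTemperedDistribution_eq, freeResolvent_apply, fourier_fourierInv_eq]
  -- With `s = (2π‖ξ‖)²` and symbol `m = 1 / (M + s)`, this is `-s m = M m - 1`.
  have h2 : ((-(2 * Real.pi) ^ 2 : ℝ) : ℂ) • TemperedDistribution.smulLeftCLM ℂ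
      (fun ξ : Space d => Complex.ofReal (‖ξ‖ ^ 2)) (g : 𝓢'(Space d, ℂ)) =
        ((M : ℂ) • g - 𝓕 f : L2 d) := by
    ext φ
    have e1 : (((-(2 * Real.pi) ^ 2 : ℝ) : ℂ) • TemperedDistribution.smulLeftCLM ℂ
      (fun ξ : Space d => Complex.ofReal (‖ξ‖ ^ 2)) (g : 𝓢'(Space d, ℂ))) φ =
      ((-(2 * Real.pi) ^ 2 : ℝ) : ℂ) • (TemperedDistribution.smulLeftCLM ℂ
      (fun ξ : Space d => Complex.ofReal (‖ξ‖ ^ 2)) (g : 𝓢'(Space d, ℂ)) φ) := rfl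
    rw [e1, TemperedDistribution.smulLeftCLM_apply_apply, Lp.toTemperedDistribution_apply,
      Lp.toTemperedDistribution_apply, ← integral_smul]
    refine integral_congr_ae ?_
    filter_upwards [coeFn_mulLp (memLp_resolventSymbol hM).toLp (𝓕 f),
      (memLp_resolventSymbol (d := d) hM).coeFn_toLp, Lp.coeFn_sub ((M : ℂ) • g) (𝓕 f),
      Lp.coeFn_smul (M : ℂ) g] with ξ h3 h4 h5 h6
    rw [SchwartzMap.smulLeftCLM_apply_apply hasTemperateGrowth_norm_sq, h5, Pi.sub_apply, h6,
      Pi.smul_apply, hg, h3, h4]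
    simp only [smul_eq_mul]
    push_cast
    linear_combination (-(φ ξ) * (𝓕 f : L2 d) ξ) * resolventSymbol_mul hM ξ
  rw [TemperedDistribution.laplacian_eq_fourierMultiplierCLM,
    TemperedDistribution.fourierMultiplierCLM_apply, h1, ← Complex.coe_smul (-(2 * Real.pi) ^ 2),
    ← fourierInv_smul, h2,
    Lp.fourierInv_toTemperedDistribution_eq, sub_eq_add_neg, fourierInv_add]
  congr 1
  rw [sub_eq_add_neg]
  congr 1
  · rw [fourierInv_smul, freeResolvent_apply]
  · rw [← neg_one_smul ℂ, fourierInv_smul, fourierInv_fourier_eq, neg_one_smul]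

/-- `(-Δ + M)⁻¹ (-Δ f + M f) = f` for Schwartz functions. -/
theorem freeResolvent_toLp {M : ℝ} (hM : 0 < M) (f : 𝓢(Space d, ℂ)) :
    freeResolvent d hM (((M : ℂ) • f - Δ f).toLp 2) = f.toLp 2 := by
  rw [freeResolvent_apply]
  have h1 : mulLp d (memLp_resolventSymbol hM).toLp (𝓕 (((M : ℂ) • f - Δ f).toLp 2)) =
      𝓕 (f.toLp 2) := by
    rw [SchwartzMap.toLp_fourier_eq, SchwartzMap.toLp_fourier_eq]
    apply Lp.ext
    filter_upwards [coeFn_mulLp (memLp_resolventSymbol hM).toLp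
      ((𝓕 ((M : ℂ) • f - Δ f)).toLp 2), (𝓕 ((M : ℂ) • f - Δ f)).coeFn_toLp 2,
      (𝓕 f).coeFn_toLp 2, (memLp_resolventSymbol (d := d) hM).coeFn_toLp] with ξ h2 h3 h4 h5
    have h6 : 𝓕 (Δ f) ξ = -(2 * Real.pi) ^ 2 • (‖ξ‖ ^ 2 • 𝓕 f ξ) := by
      rw [SchwartzMap.laplacian_eq_fourierMultiplierCLM, SchwartzMap.fourierMultiplierCLM_apply,
        ← fourierInv_smul, fourier_fourierInv_eq, smul_apply,
        SchwartzMap.smulLeftCLM_apply_apply (by fun_prop)]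
    have h7 : 𝓕 ((M : ℂ) • f - Δ f) ξ = (M : ℂ) • 𝓕 f ξ - 𝓕 (Δ f) ξ := by
      rw [sub_eq_add_neg, ← neg_one_smul ℂ, FourierAdd.fourier_add, fourier_smul, fourier_smul]
      simp [sub_eq_add_neg]
    rw [h2, h3, h4, h5, h7, h6]
    simp only [smul_eq_mul, Complex.real_smul]
    push_cast
    linear_combination (𝓕 f ξ) * resolventSymbol_mul hM ξ
  rw [h1, fourierInv_fourier_eq]

end Resolvent

/-! ### From test functions to negative eigenvalues. -/

section Criterion

open scoped InnerProductSpace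

variable {d : ℕ}

theorem re_inner_eq_integral (f g : L2 d) :
    (⟪f, g⟫_ℂ).re = ∫ x, (⟪f x, g x⟫_ℂ).re := by
  rw [L2.inner_def]
  exact (integral_re (L2.integrable_inner (𝕜 := ℂ) f g)).symm

theorem inner_eq_zero_of_ae {f g : L2 d} (h : ∀ᵐ x, f x = 0 ∨ g x = 0) : ⟪f, g⟫_ℂ = 0 := by
  rw [L2.inner_def]
  refine integral_eq_zero_of_ae ?_
  filter_upwards [h] with x hx
  rcases hx with hx | hx <;> simp [hx]

theorem memLp_top_ofReal {U : Space d → ℝ} {B : ℝ} (hUm : AEMeasurable U volume)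
    (hUB : ∀ᵐ x, 0 ≤ U x ∧ U x ≤ B) : MemLp (fun x => (U x : ℂ)) ∞ volume := by
  refine memLp_top_of_bound hUm.complex_ofReal.aestronglyMeasurable B ?_
  filter_upwards [hUB] with x hx
  rw [Complex.norm_real, Real.norm_eq_abs, abs_of_nonneg hx.1]
  exact hx.2

/-- Pointwise, `U ^ 2 ≤ B U`. -/
theorem norm_sq_mulLp_le {U : Space d → ℝ} {B : ℝ} (hUm : AEMeasurable U volume)
    (hUB : ∀ᵐ x, 0 ≤ U x ∧ U x ≤ B) (f : L2 d) :
    ‖mulLp d (memLp_top_ofReal hUm hUB).toLp f‖ ^ 2 ≤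
      B * (⟪f, mulLp d (memLp_top_ofReal hUm hUB).toLp f⟫_ℂ).re := by
  set u := mulLp d (memLp_top_ofReal hUm hUB).toLp f with hu
  have h : 0 ≤ (⟪u, (B : ℂ) • f - u⟫_ℂ).re := by
    rw [re_inner_eq_integral]
    refine integral_nonneg_of_ae ?_
    filter_upwards [hUB, coeFn_mulLp (memLp_top_ofReal hUm hUB).toLp f,
      (memLp_top_ofReal hUm hUB).coeFn_toLp, Lp.coeFn_sub ((B : ℂ) • f) u,
      Lp.coeFn_smul (B : ℂ) f] with x h1 h2 h3 h4 h5
    rw [h4, Pi.sub_apply, h5, Pi.smul_apply, hu, h2, h3, smul_eq_mul, ← sub_mul,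
      RCLike.inner_apply, map_mul, Complex.conj_ofReal]
    have e : ((B : ℂ) - U x) * f x * (U x * (starRingEnd ℂ) (f x)) =
        (((B - U x) * U x * ‖f x‖ ^ 2 : ℝ) : ℂ) := by
      push_cast
      rw [← Complex.mul_conj']
      ring
    rw [e, Complex.ofReal_re]
    exact mul_nonneg (mul_nonneg (sub_nonneg.mpr h1.2) h1.1) (sq_nonneg _)
  have hn : (⟪u, u⟫_ℂ).re = ‖u‖ ^ 2 := by simpa using inner_self_eq_norm_sq (𝕜 := ℂ) u
  have hs : (⟪u, f⟫_ℂ).re = (⟪f, u⟫_ℂ).re := inner_re_symm (𝕜 := ℂ) _ _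
  rw [inner_sub_right, inner_smul_right, Complex.sub_re, Complex.re_ofReal_mul, hn, hs] at h
  linarith

/-- The eigenvector is `v = l ψ`: the hypothesis says `(-Δ + M) v = ψ + U v`, that is, `(-Δ - U) v =
ψ - M v`. -/
theorem schrodinger_isEigenvalue {U : Space d → ℝ} {B : ℝ} (hUm : AEMeasurable U volume)
    (hUB : ∀ᵐ x, 0 ≤ U x ∧ U x ≤ B) {M : ℝ} (hM : 0 < M) {l : ℝ} (hl : 0 < l) {ψ : L2 d}
    (hψ : ψ ≠ 0) (h : (l : ℂ) • ψ = freeResolvent d hM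
      (ψ + (l : ℂ) • mulLp d (memLp_top_ofReal hUm hUB).toLp ψ)) :
    IsEigenvalue (schrodinger fun x => -U x) (l⁻¹ - M) := by
  have hl0 : (l : ℂ) ≠ 0 := Complex.ofReal_ne_zero.mpr hl.ne'
  set A := mulLp d (memLp_top_ofReal hUm hUB).toLp with hA
  set v : L2 d := (l : ℂ) • ψ with hv
  have hAv : (l : ℂ) • A ψ = A v := (map_smul A _ _).symm
  rw [hAv] at h
  have hlap : Δ (v : 𝓢'(Space d, ℂ)) = ((M : ℂ) • v - (ψ + A v) : L2 d) := by
    have := laplacian_freeResolvent hM (ψ + A v)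
    rwa [← h] at this
  have hdom : v ∈ (laplacian d).domain := mem_laplacian_domain.mpr ⟨_, hlap⟩
  have hmul : (fun x => ((-U x : ℝ) : ℂ) * v x) =ᵐ[volume] (-A v : L2 d) := by
    filter_upwards [coeFn_mulLp (memLp_top_ofReal hUm hUB).toLp v,
      (memLp_top_ofReal hUm hUB).coeFn_toLp, Lp.coeFn_neg (A v)] with x h1 h2 h3
    rw [h3, Pi.neg_apply, hA, h1, h2]
    push_cast
    ring
  have hmdom : v ∈ mulDomain fun x => -U x :=
    mem_mulDomain.mpr ((memLp_congr_ae hmul).mpr (Lp.memLp _))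
  refine ⟨⟨v, hdom, hmdom⟩, smul_ne_zero hl0 hψ, ?_⟩
  have e1 : laplacian d ⟨v, hdom⟩ = (M : ℂ) • v - (ψ + A v) := by
    apply toDist_injective
    rw [toDist_apply, toDist_apply, laplacian_apply]
    exact hlap
  have e2 : mulFun (fun x => -U x) ⟨v, hmdom⟩ = -A v :=
    Lp.ext ((coeFn_mulFun _ _).trans hmul)
  have e3 : schrodinger (fun x => -U x) ⟨v, hdom, hmdom⟩ =
      -laplacian d ⟨v, hdom⟩ + mulFun (fun x => -U x) ⟨v, hmdom⟩ := rfl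
  have e4 : ψ = ((l⁻¹ : ℝ) : ℂ) • v := by
    rw [hv, smul_smul, Complex.ofReal_inv, inv_mul_cancel₀ hl0, one_smul]
  rw [e3, e1, e2, Complex.ofReal_sub, sub_smul, ← e4]
  change -((M : ℂ) • v - (ψ + A v)) + -A v = ψ - (M : ℂ) • v
  abel

/-- For `f = φ`, `D = Δ φ`, `u = U φ`, the third vector is `(H + M) φ = M f + a` with `a = -D - u`.
Expanding the square and cancelling `M ‖f‖ ^ 2` reduces the claim to `‖a‖ ^ 2 < -M Re ⟪f, a⟫`. The
choice `M = 4 B + 1` lets half of the potential energy absorb the `2 ‖u‖ ^ 2` in `‖a‖ ^ 2`. -/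
theorem inv_mul_norm_sq_lt_re_inner {H : Type*} [NormedAddCommGroup H] [InnerProductSpace ℂ H]
    {B : ℝ} (hB : 0 ≤ B) {f D u : H} (hu : ‖u‖ ^ 2 ≤ B * (⟪f, u⟫_ℂ).re)
    (hpos : ‖f‖ * ‖D‖ + 2 * ‖D‖ ^ 2 < 2⁻¹ * (⟪f, u⟫_ℂ).re) :
    (4 * B + 1)⁻¹ * ‖((4 * B + 1 : ℝ) : ℂ) • f - D - u‖ ^ 2 <
      (⟪f, ((4 * B + 1 : ℝ) : ℂ) • f - D - u⟫_ℂ).re := by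
  set M : ℝ := 4 * B + 1 with hMdef
  have hM : 0 < M := by positivity
  set q := (⟪f, u⟫_ℂ).re with hq
  set a := -D - u with ha
  have e1 : (M : ℂ) • f - D - u = (M : ℂ) • f + a := by
    rw [ha]
    abel
  have hn : ∀ g : H, (⟪g, g⟫_ℂ).re = ‖g‖ ^ 2 := fun g => by
    simpa using inner_self_eq_norm_sq (𝕜 := ℂ) g
  have e2 : ‖(M : ℂ) • f + a‖ ^ 2 =
      M ^ 2 * ‖f‖ ^ 2 + 2 * (M * (⟪f, a⟫_ℂ).re) + ‖a‖ ^ 2 := by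
    rw [norm_add_sq (𝕜 := ℂ), norm_smul, inner_smul_left, Complex.conj_ofReal,
      RCLike.re_to_complex, Complex.re_ofReal_mul, Complex.norm_real, Real.norm_eq_abs,
      abs_of_pos hM]
    ring
  have e3 : (⟪f, (M : ℂ) • f + a⟫_ℂ).re = M * ‖f‖ ^ 2 + (⟪f, a⟫_ℂ).re := by
    rw [inner_add_right, inner_smul_right, Complex.add_re, Complex.re_ofReal_mul, hn]
  have e4 : (⟪f, a⟫_ℂ).re = -(⟪f, D⟫_ℂ).re - q := by
    rw [ha, inner_sub_right, inner_neg_right, Complex.sub_re, Complex.neg_re]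
  have e5 : -(⟪f, D⟫_ℂ).re ≤ ‖f‖ * ‖D‖ := by
    have := re_inner_le_norm (𝕜 := ℂ) (-f) D
    rwa [inner_neg_left, norm_neg] at this
  have e6 : ‖a‖ ^ 2 ≤ 2 * ‖D‖ ^ 2 + 2 * ‖u‖ ^ 2 := by
    have : ‖a‖ ≤ ‖D‖ + ‖u‖ := by
      have := norm_sub_le (-D) u
      rwa [norm_neg] at this
    nlinarith [norm_nonneg a, sq_nonneg (‖D‖ - ‖u‖)]
  rw [inv_mul_lt_iff₀ hM, e1, e2, e3]
  have e9 : ‖a‖ ^ 2 < M * (-(⟪f, a⟫_ℂ).re) := by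
    have e10 : q - ‖f‖ * ‖D‖ ≤ -(⟪f, a⟫_ℂ).re := by
      rw [e4]
      linarith
    have e11 : 2⁻¹ * q + 2 * ‖D‖ ^ 2 < -(⟪f, a⟫_ℂ).re := by linarith
    have e12 := mul_lt_mul_of_pos_left e11 hM
    have e13 : 0 ≤ B * ‖D‖ ^ 2 := by positivity
    have e14 : M * (2⁻¹ * q + 2 * ‖D‖ ^ 2) =
        2 * (B * q) + 2⁻¹ * q + 8 * (B * ‖D‖ ^ 2) + 2 * ‖D‖ ^ 2 := by
      rw [hMdef]
      ring
    have e15 : 0 ≤ ‖f‖ * ‖D‖ := by positivity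
    have e16 : 0 ≤ ‖D‖ ^ 2 := by positivity
    linarith
  linarith

theorem toLp_apply_of_notMem_tsupport (φ : 𝓢(Space d, ℂ)) :
    ∀ᵐ x, x ∉ tsupport φ → φ.toLp 2 volume x = 0 := by
  filter_upwards [φ.coeFn_toLp 2] with x hx hxs
  rw [hx, image_eq_zero_of_notMem_tsupport hxs]

/-- Locality of `-Δ - U + M`: disjoint supports of test functions yield both orthogonality
relations. -/
theorem toLp_sub_mulLp_apply_of_notMem_tsupport (w : Lp ℂ ∞ (volume : Measure (Space d))) (M : ℂ)
    (φ : 𝓢(Space d, ℂ)) : ∀ᵐ x, x ∉ tsupport φ →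
      (M • φ.toLp 2 volume - (Δ φ).toLp 2 volume - mulLp d w (φ.toLp 2 volume)) x = 0 := by
  set f := φ.toLp 2 volume
  set D := (Δ φ).toLp 2 volume
  filter_upwards [toLp_apply_of_notMem_tsupport φ, (Δ φ).coeFn_toLp 2, coeFn_mulLp w f,
    Lp.coeFn_smul M f, Lp.coeFn_sub (M • f) D, Lp.coeFn_sub (M • f - D) (mulLp d w f)]
    with x h1 h2 h3 h4 h5 h6 hxs
  have h7 : Δ φ x = 0 := by
    rw [SchwartzMap.laplacian_apply]
    have hz : (φ : Space d → ℂ) =ᶠ[𝓝 x] fun _ => 0 := notMem_tsupport_iff_eventuallyEq.mp hxs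
    rw [(InnerProductSpace.laplacian_congr_nhds hz).self_of_nhds,
      InnerProductSpace.laplacian_const, Pi.zero_apply]
  rw [h6, Pi.sub_apply, h5, Pi.sub_apply, h4, Pi.smul_apply, h1 hxs, h3, h1 hxs, h2, h7]
  simp

theorem re_inner_mulLp_toLp {U : Space d → ℝ} {B : ℝ} (hUm : AEMeasurable U volume)
    (hUB : ∀ᵐ x, 0 ≤ U x ∧ U x ≤ B) (φ : 𝓢(Space d, ℂ)) :
    (⟪φ.toLp 2 volume, mulLp d (memLp_top_ofReal hUm hUB).toLp (φ.toLp 2 volume)⟫_ℂ).re =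
      ∫ x, U x * ‖φ x‖ ^ 2 := by
  rw [re_inner_eq_integral]
  refine integral_congr_ae ?_
  filter_upwards [φ.coeFn_toLp 2, coeFn_mulLp (memLp_top_ofReal hUm hUB).toLp (φ.toLp 2 volume),
    (memLp_top_ofReal hUm hUB).coeFn_toLp] with x h1 h2 h3
  rw [h2, h3, h1, RCLike.inner_apply, mul_assoc, Complex.mul_conj']
  norm_cast

theorem re_inner_freeResolvent_le {M : ℝ} (hM : 0 < M) (g : L2 d) :
    (⟪freeResolvent d hM g, g⟫_ℂ).re ≤ M⁻¹ * ‖g‖ ^ 2 := by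
  calc (⟪freeResolvent d hM g, g⟫_ℂ).re ≤ ‖freeResolvent d hM g‖ * ‖g‖ :=
        re_inner_le_norm (𝕜 := ℂ) _ _
    _ ≤ (M⁻¹ * ‖g‖) * ‖g‖ := by
      gcongr
      exact ContinuousLinearMap.le_of_opNorm_le _ (norm_freeResolvent_le hM) g
    _ = M⁻¹ * ‖g‖ ^ 2 := by ring

theorem freeResolvent_toLp_smul_sub {M : ℝ} (hM : 0 < M) (φ : 𝓢(Space d, ℂ)) :
    freeResolvent d hM ((M : ℂ) • φ.toLp 2 volume - (Δ φ).toLp 2 volume) = φ.toLp 2 volume := by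
  rw [← freeResolvent_toLp hM φ]
  congr 1
  change _ = SchwartzMap.toLpCLM ℂ ℂ 2 volume ((M : ℂ) • φ - Δ φ)
  rw [map_sub, map_smul, freeResolvent_toLp hM φ]
  rfl

theorem norm_mulLp_ofReal_le {U : Space d → ℝ} {B : ℝ} (hB : 0 ≤ B) (hUm : AEMeasurable U volume)
    (hUB : ∀ᵐ x, 0 ≤ U x ∧ U x ≤ B) : ‖mulLp d (memLp_top_ofReal hUm hUB).toLp‖ ≤ B := by
  refine (norm_mulLp_le _).trans (norm_le_of_ae_bound_top hB ?_)
  filter_upwards [(memLp_top_ofReal hUm hUB).coeFn_toLp, hUB] with x hx h1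
  rw [hx, Complex.norm_real, Real.norm_eq_abs, abs_of_nonneg h1.1]
  exact h1.2

theorem isSelfAdjoint_mulLp_ofReal {U : Space d → ℝ} {B : ℝ} (hUm : AEMeasurable U volume)
    (hUB : ∀ᵐ x, 0 ≤ U x ∧ U x ≤ B) :
    IsSelfAdjoint (mulLp d (memLp_top_ofReal hUm hUB).toLp) := by
  refine isSelfAdjoint_mulLp ?_
  filter_upwards [(memLp_top_ofReal hUm hUB).coeFn_toLp] with x hx
  rw [hx, Complex.ofReal_im]

theorem vanishesAtInfinity_ofReal {U : Space d → ℝ} {B : ℝ} (hUm : AEMeasurable U volume)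
    (hUB : ∀ᵐ x, 0 ≤ U x ∧ U x ≤ B)
    (hvan : ∀ ε : ℝ, 0 < ε → ∃ R : ℝ, ∀ᵐ x, R < ‖x‖ → U x ≤ ε) :
    VanishesAtInfinity (memLp_top_ofReal hUm hUB).toLp := by
  intro ε hε
  obtain ⟨R, hR⟩ := hvan ε hε
  refine ⟨R, ?_⟩
  filter_upwards [hR, hUB, (memLp_top_ofReal hUm hUB).coeFn_toLp] with x h1 h2 h3 hx
  rw [h3, Complex.norm_real, Real.norm_eq_abs, abs_of_nonneg h2.1]
  exact h1 hx

/-- `-Δ - U`, with `U ≥ 0` bounded and vanishing at infinity, has infinitely many negative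
eigenvalues if there are infinitely many test functions with disjoint supports and sufficiently
negative energy. -/
theorem infinite_negative_eigenvalues {U : Space d → ℝ} {B : ℝ} (hUm : AEMeasurable U volume)
    (hUB : ∀ᵐ x, 0 ≤ U x ∧ U x ≤ B)
    (hvan : ∀ ε : ℝ, 0 < ε → ∃ R : ℝ, ∀ᵐ x, R < ‖x‖ → U x ≤ ε)
    (φ : ℕ → 𝓢(Space d, ℂ))
    (hdisj : ∀ n m, n ≠ m → Disjoint (tsupport (φ n)) (tsupport (φ m)))
    (hpos : ∀ n, ‖(φ n).toLp 2‖ * ‖(Δ (φ n)).toLp 2‖ + 2 * ‖(Δ (φ n)).toLp 2‖ ^ 2 <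
      2⁻¹ * ∫ x, U x * ‖φ n x‖ ^ 2) :
    {E : ℝ | E < 0 ∧ IsEigenvalue (schrodinger fun x => -U x) E}.Infinite := by
  have hB : 0 ≤ B := by
    obtain ⟨x, hx⟩ := hUB.exists
    exact hx.1.trans hx.2
  have hM : 0 < 4 * B + 1 := by positivity
  have hdisj' : ∀ n m, n ≠ m → ∀ x, x ∉ tsupport (φ n) ∨ x ∉ tsupport (φ m) := by
    intro n m hnm x
    by_contra! hx
    exact Set.disjoint_left.mp (hdisj n m hnm) hx.1 hx.2
  have hGA : ‖freeResolvent d hM * mulLp d (memLp_top_ofReal hUm hUB).toLp‖ < 1 := by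
    refine (norm_mul_le _ _).trans_lt ?_
    calc _ ≤ (4 * B + 1)⁻¹ * B := mul_le_mul (norm_freeResolvent_le hM)
          (norm_mulLp_ofReal_le hB hUm hUB) (norm_nonneg _) (inv_nonneg.mpr hM.le)
      _ < 1 := by
        rw [inv_mul_lt_iff₀ hM]
        linarith
  have hinf := infinite_setOf_perturbed_eigenvalue (isSelfAdjoint_freeResolvent hM)
    (isSelfAdjoint_mulLp_ofReal hUm hUB) hGA
    (isCompactOperator_mul_freeResolvent hM (vanishesAtInfinity_ofReal hUm hUB hvan))
    (inv_nonneg.mpr hM.le) (re_inner_freeResolvent_le hM) (f := fun n => (φ n).toLp 2 volume)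
    (h := fun n => ((4 * B + 1 : ℝ) : ℂ) • (φ n).toLp 2 volume - (Δ (φ n)).toLp 2 volume -
      mulLp d (memLp_top_ofReal hUm hUB).toLp ((φ n).toLp 2 volume))
    (fun n => by rw [sub_add_cancel, freeResolvent_toLp_smul_sub])
    (fun n m hnm => inner_eq_zero_of_ae (by
      filter_upwards [toLp_apply_of_notMem_tsupport (φ n),
        toLp_sub_mulLp_apply_of_notMem_tsupport _ _ (φ m)] with x h1 h2
      exact (hdisj' n m hnm x).imp h1 h2))
    (fun n m hnm => inner_eq_zero_of_ae (by
      filter_upwards [toLp_sub_mulLp_apply_of_notMem_tsupport _ _ (φ n),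
        toLp_sub_mulLp_apply_of_notMem_tsupport _ _ (φ m)] with x h1 h2
      exact (hdisj' n m hnm x).imp h1 h2))
    (fun n => inv_mul_norm_sq_lt_re_inner hB (norm_sq_mulLp_le hUm hUB _)
      (by rw [re_inner_mulLp_toLp hUm hUB]; exact hpos n))
  -- `l ↦ l⁻¹ - M` is injective, so distinct eigenvalues of the resolvent stay distinct.
  have himg := hinf.image (f := fun l : ℝ => l⁻¹ - (4 * B + 1)) (by
    intro x _ y _ hxy
    exact inv_injective (sub_left_injective hxy))
  refine himg.mono ?_
  rintro _ ⟨l, ⟨hl, ψ, hψ, hlψ⟩, rfl⟩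
  have hl0 : 0 < l := (inv_pos.mpr hM).trans hl
  exact ⟨sub_neg.mpr (inv_lt_of_inv_lt₀ hM hl), schrodinger_isEigenvalue hUm hUB hM hl0 hψ hlψ⟩

end Criterion

/-! ### Dilated bump functions and their kinetic energy. -/

section TestFunctions

open scoped InnerProductSpace

variable {d : ℕ}

theorem norm_sq_toLp_eq_integral (φ : 𝓢(Space d, ℂ)) :
    ‖φ.toLp 2 volume‖ ^ 2 = ∫ x, ‖φ x‖ ^ 2 := by
  have h : (⟪φ.toLp 2 volume, φ.toLp 2 volume⟫_ℂ).re = ‖φ.toLp 2 volume‖ ^ 2 := by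
    simpa using inner_self_eq_norm_sq (𝕜 := ℂ) (φ.toLp 2 volume)
  rw [← h, re_inner_eq_integral]
  refine integral_congr_ae ?_
  filter_upwards [φ.coeFn_toLp 2] with x hx
  rw [hx]
  simpa using inner_self_eq_norm_sq (𝕜 := ℂ) (φ x)

theorem laplacian_comp_const_smul {f : Space d → ℂ} (hf : ContDiff ℝ 2 f) (a : ℝ) (x : Space d) :
    Δ (fun y => f (a • y)) x = ((a ^ 2 : ℝ) : ℂ) * Δ f (a • x) := by
  rw [InnerProductSpace.laplacian_eq_iteratedFDeriv_stdOrthonormalBasis,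
    InnerProductSpace.laplacian_eq_iteratedFDeriv_stdOrthonormalBasis,
    iteratedFDeriv_comp_const_smul a (by exact_mod_cast hf), Finset.mul_sum]
  refine Finset.sum_congr rfl fun i _ => ?_
  simp

/-- The dilation `x ↦ ϕ (x / R)` of a test function. -/
theorem exists_dilation (ϕ : 𝓢(Space d, ℂ)) (hϕ : HasCompactSupport ϕ) {R : ℝ} (hR : 0 < R) :
    ∃ φ : 𝓢(Space d, ℂ), (∀ x, φ x = ϕ (R⁻¹ • x)) ∧
      ‖φ.toLp 2 volume‖ ^ 2 = R ^ d * ‖ϕ.toLp 2 volume‖ ^ 2 ∧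
      ‖(Δ φ).toLp 2 volume‖ ^ 2 = R ^ d / R ^ 4 * ‖(Δ ϕ).toLp 2 volume‖ ^ 2 := by
  have h1 : HasCompactSupport fun x => ϕ (R⁻¹ • x) :=
    hϕ.comp_homeomorph (Homeomorph.smulOfNeZero R⁻¹ (inv_ne_zero hR.ne'))
  have h2 : ContDiff ℝ (⊤ : ℕ∞) fun x => ϕ (R⁻¹ • x) :=
    (ϕ.smooth ⊤).comp (contDiff_const_smul R⁻¹)
  refine ⟨h1.toSchwartzMap h2, fun x => rfl, ?_, ?_⟩
  · rw [norm_sq_toLp_eq_integral, norm_sq_toLp_eq_integral]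
    have := Measure.integral_comp_inv_smul_of_nonneg (μ := (volume : Measure (Space d)))
      (fun x => ‖ϕ x‖ ^ 2) hR.le
    rw [finrank_euclideanSpace_fin, smul_eq_mul] at this
    exact this
  · rw [norm_sq_toLp_eq_integral, norm_sq_toLp_eq_integral]
    have h3 : ∀ x, ‖Δ (h1.toSchwartzMap h2) x‖ ^ 2 = (R ^ 4)⁻¹ * ‖Δ ϕ (R⁻¹ • x)‖ ^ 2 := by
      intro x
      rw [SchwartzMap.laplacian_apply, SchwartzMap.laplacian_apply]
      have h4 : Δ (h1.toSchwartzMap h2 : Space d → ℂ) x =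
          (((R⁻¹) ^ 2 : ℝ) : ℂ) * Δ (ϕ : Space d → ℂ) (R⁻¹ • x) :=
        laplacian_comp_const_smul (by exact_mod_cast ϕ.smooth 2) R⁻¹ x
      rw [h4, norm_mul, mul_pow, Complex.norm_real, Real.norm_eq_abs, sq_abs]
      congr 1
      rw [← inv_pow]
      ring
    have := Measure.integral_comp_inv_smul_of_nonneg (μ := (volume : Measure (Space d)))
      (fun x => ‖Δ ϕ x‖ ^ 2) hR.le
    rw [finrank_euclideanSpace_fin, smul_eq_mul] at this
    simp_rw [h3]
    rw [integral_const_mul, this]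
    ring

/-- Test functions of length scale `R ≥ 1` around `R v`, whose kinetic energy is of order
`R ^ (d - 2)`. -/
theorem exists_testFunction (v : Space d) :
    ∃ C : ℝ, ∀ R : ℝ, 1 ≤ R → ∃ φ : 𝓢(Space d, ℂ),
      tsupport φ ⊆ Metric.closedBall (R • v) (2 * R) ∧
      (∀ x ∈ Metric.closedBall (R • v) R, φ x = 1) ∧
      ‖φ.toLp 2 volume‖ * ‖(Δ φ).toLp 2 volume‖ + 2 * ‖(Δ φ).toLp 2 volume‖ ^ 2 ≤
        C * (R ^ d / R ^ 2) := by
  let b : ContDiffBump v := ⟨1, 2, one_pos, one_lt_two⟩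
  have h1 : HasCompactSupport (fun x => (b x : ℂ)) :=
    b.hasCompactSupport.comp_left (g := Complex.ofReal) Complex.ofReal_zero
  have h2 : ContDiff ℝ (⊤ : ℕ∞) (fun x => (b x : ℂ)) :=
    Complex.ofRealCLM.contDiff.comp (b.contDiff (n := (⊤ : ℕ∞)))
  set ϕ : 𝓢(Space d, ℂ) := h1.toSchwartzMap h2 with hϕ
  have hϕa : ∀ x, ϕ x = (b x : ℂ) := fun x => rfl
  refine ⟨‖ϕ.toLp 2 volume‖ ^ 2 + 3 * ‖(Δ ϕ).toLp 2 volume‖ ^ 2, fun R hR => ?_⟩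
  have hR0 : 0 < R := one_pos.trans_le hR
  obtain ⟨φ, hφ, hn, hΔ⟩ := exists_dilation ϕ h1 hR0
  have hdist : ∀ x, dist (R⁻¹ • x) v = R⁻¹ * dist x (R • v) := by
    intro x
    have : R⁻¹ • x - v = R⁻¹ • (x - R • v) := by
      rw [smul_sub, smul_smul, inv_mul_cancel₀ hR0.ne', one_smul]
    rw [dist_eq_norm, dist_eq_norm, this, norm_smul, norm_inv, Real.norm_eq_abs, abs_of_pos hR0]
  refine ⟨φ, ?_, ?_, ?_⟩
  · refine closure_minimal ?_ Metric.isClosed_closedBall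
    intro x hx
    rw [Metric.mem_closedBall]
    by_contra! hlt
    refine hx ?_
    rw [hφ, hϕa, b.zero_of_le_dist, Complex.ofReal_zero]
    rw [hdist, le_inv_mul_iff₀ hR0]
    change R * 2 ≤ _
    linarith
  · intro x hx
    rw [Metric.mem_closedBall] at hx
    rw [hφ, hϕa, b.one_of_mem_closedBall, Complex.ofReal_one]
    rw [Metric.mem_closedBall, hdist, inv_mul_le_iff₀ hR0]
    change _ ≤ R * 1
    linarith
  · set A := ‖φ.toLp 2 volume‖
    set D := ‖(Δ φ).toLp 2 volume‖
    set a := ‖ϕ.toLp 2 volume‖ ^ 2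
    set c := ‖(Δ ϕ).toLp 2 volume‖ ^ 2
    have ha : 0 ≤ a := sq_nonneg _
    have hc : 0 ≤ c := sq_nonneg _
    have hR2 : 0 < R ^ 2 := by positivity
    have hRd : 0 < R ^ d := by positivity
    -- The weights `1 / R` and `R` balance the two scalings: both squares become multiples of `R ^ d
    -- / R ^ 2`.
    have e1 : A * D ≤ 2⁻¹ * (A ^ 2 / R ^ 2 + R ^ 2 * D ^ 2) := by
      have e2 := sq_nonneg (A / R - R * D)
      have e3 : (A / R - R * D) ^ 2 = A ^ 2 / R ^ 2 + R ^ 2 * D ^ 2 - 2 * (A * D) := by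
        field_simp
        ring
      linarith
    have e4 : A ^ 2 / R ^ 2 = a * (R ^ d / R ^ 2) := by
      rw [hn]
      ring
    have e5 : R ^ 2 * D ^ 2 = c * (R ^ d / R ^ 2) := by
      rw [hΔ]
      field_simp
    have e6 : D ^ 2 ≤ c * (R ^ d / R ^ 2) := by
      rw [← e5]
      have : 1 ≤ R ^ 2 := one_le_pow₀ hR
      nlinarith [sq_nonneg D]
    have e7 : 0 ≤ R ^ d / R ^ 2 := by positivity
    rw [e4, e5] at e1
    nlinarith [mul_nonneg ha e7, mul_nonneg hc e7]

end TestFunctions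

/-! ### The lattice sum: local finiteness, bounds, measurability. -/

section Potential

variable {d : ℕ}

/-- A finite set of lattice sites that contains those at distance at most `ρ` from `x`. -/
def nearSites (ρ : ℝ) (x : Space d) : Finset (Fin d → ℤ) :=
  Fintype.piFinset fun i => Finset.Icc ⌈x i - ρ⌉ ⌊x i + ρ⌋

theorem mem_nearSites {ρ : ℝ} {x : Space d} {j : Fin d → ℤ} (h : ‖x - latticePoint j‖ ≤ ρ) :
    j ∈ nearSites ρ x := by
  rw [nearSites, Fintype.mem_piFinset]
  intro i
  have h1 : |x i - j i| ≤ ρ := (PiLp.norm_apply_le (x - latticePoint j) i).trans h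
  rw [abs_le] at h1
  rw [Finset.mem_Icc, Int.ceil_le, Int.le_floor]
  constructor <;> linarith

theorem card_nearSites_le {ρ : ℝ} (hρ : 0 ≤ ρ) (x : Space d) :
    ((nearSites ρ x).card : ℝ) ≤ (2 * ρ + 1) ^ d := by
  rw [nearSites, Fintype.card_piFinset, Nat.cast_prod]
  calc ∏ i, ((Finset.Icc ⌈x i - ρ⌉ ⌊x i + ρ⌋).card : ℝ) ≤ ∏ _i : Fin d, (2 * ρ + 1) := by
        refine Finset.prod_le_prod (fun i _ => Nat.cast_nonneg _) fun i _ => ?_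
        rw [Int.card_Icc]
        have h1 := Int.floor_le (x i + ρ)
        have h2 := Int.le_ceil (x i - ρ)
        have h3 : (((⌊x i + ρ⌋ + 1 - ⌈x i - ρ⌉).toNat : ℤ) : ℝ) =
            max ((⌊x i + ρ⌋ + 1 - ⌈x i - ρ⌉ : ℤ) : ℝ) 0 := by
          rw [Int.toNat_eq_max]
          push_cast
          rfl
        rw [Int.cast_natCast] at h3
        rw [h3]
        refine max_le ?_ (by linarith)
        push_cast
        linarith
    _ = (2 * ρ + 1) ^ d := by simp

/-- The single-site potential is bounded and of finite range at the point `x`, relative to all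
sites. -/
structure RegularAt (u : Space d → ℝ) (u₀ ρ : ℝ) (x : Space d) : Prop where
  nonneg : ∀ j : Fin d → ℤ, 0 ≤ u (x - latticePoint j)
  le : ∀ j : Fin d → ℤ, u (x - latticePoint j) ≤ u₀
  eq_zero : ∀ j : Fin d → ℤ, ρ < ‖x - latticePoint j‖ → u (x - latticePoint j) = 0

/-- Translations preserve null sets, and there are countably many lattice points. -/
theorem ae_forall_latticePoint {p : Space d → Prop} (h : ∀ᵐ x, p x) :
    ∀ᵐ x : Space d, ∀ j : Fin d → ℤ, p (x - latticePoint j) :=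
  ae_all_iff.mpr fun j =>
    (measurePreserving_sub_right volume (latticePoint j)).quasiMeasurePreserving.ae h

theorem ae_regularAt {u : Space d → ℝ} {u₀ ρ : ℝ} (hu : ∀ᵐ x, 0 ≤ u x ∧ u x ≤ u₀)
    (hρ : ∀ᵐ x, ρ < ‖x‖ → u x = 0) : ∀ᵐ x, RegularAt u u₀ ρ x := by
  filter_upwards [ae_forall_latticePoint hu, ae_forall_latticePoint hρ] with x h1 h2
  exact ⟨fun j => (h1 j).1, fun j => (h1 j).2, h2⟩

variable {u : Space d → ℝ} {u₀ ρ : ℝ} {x : Space d} {w : (Fin d → ℤ) → ℝ}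

theorem RegularAt.term_eq_zero (hx : RegularAt u u₀ ρ x) {j : Fin d → ℤ}
    (hj : j ∉ nearSites ρ x) : w j * u (x - latticePoint j) = 0 := by
  rw [hx.eq_zero j (not_le.mp fun h => hj (mem_nearSites h)), mul_zero]

theorem RegularAt.summable (hx : RegularAt u u₀ ρ x) :
    Summable fun j : Fin d → ℤ => w j * u (x - latticePoint j) :=
  summable_of_ne_finset_zero fun _ hj => hx.term_eq_zero hj

theorem RegularAt.sum_le (hx : RegularAt u u₀ ρ x) (hw : ∀ j, 0 ≤ w j)
    (A : Finset (Fin d → ℤ)) : ∑ j ∈ A, w j * u (x - latticePoint j) ≤ -potential u w x := by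
  rw [potential, neg_neg]
  exact hx.summable.sum_le_tsum A fun j _ => mul_nonneg (hw j) (hx.nonneg j)

theorem RegularAt.neg_potential_nonneg (hx : RegularAt u u₀ ρ x) (hw : ∀ j, 0 ≤ w j) :
    0 ≤ -potential u w x := by
  simpa using hx.sum_le hw ∅

theorem RegularAt.neg_potential_le (hx : RegularAt u u₀ ρ x) (hρ : 0 ≤ ρ) (hu₀ : 0 ≤ u₀)
    (hw : ∀ j, 0 ≤ w j ∧ w j ≤ 1) : -potential u w x ≤ (2 * ρ + 1) ^ d * u₀ := by
  rw [potential, neg_neg, tsum_eq_sum (s := nearSites ρ x) fun _ hj => hx.term_eq_zero hj]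
  calc ∑ j ∈ nearSites ρ x, w j * u (x - latticePoint j) ≤ ∑ _j ∈ nearSites ρ x, u₀ := by
        refine Finset.sum_le_sum fun j _ => ?_
        have h1 := hw j
        have h2 := hx.nonneg j
        have h3 := hx.le j
        nlinarith
    _ = (nearSites ρ x).card * u₀ := by rw [Finset.sum_const, nsmul_eq_mul]
    _ ≤ (2 * ρ + 1) ^ d * u₀ := by
      gcongr
      exact card_nearSites_le hρ x

theorem aemeasurable_potential (hum : AEMeasurable u volume)
    (hreg : ∀ᵐ x, RegularAt u u₀ ρ x) : AEMeasurable (potential u w) volume := by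
  refine AEMeasurable.neg ?_
  refine aemeasurable_of_tendsto_metrizable_ae (atTop : Filter (Finset (Fin d → ℤ)))
    (f := fun s x => ∑ j ∈ s, w j * u (x - latticePoint j)) (fun s => ?_) ?_
  · refine Finset.aemeasurable_fun_sum s fun j _ => AEMeasurable.const_mul ?_ _
    exact hum.comp_quasiMeasurePreserving
      (measurePreserving_sub_right volume (latticePoint j)).quasiMeasurePreserving
  · filter_upwards [hreg] with x hx
    exact hx.summable.hasSum

end Potential

/-! ### Lattice boxes inside the plateaus of the test functions. -/

section Box

variable {d : ℕ}

/-- The lattice sites in a box of side `n` with corner `16 d n e`, where `e` is the unit vector in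
direction `i₀`. -/
def latticeBox (i₀ : Fin d) (n : ℕ) : Finset (Fin d → ℤ) :=
  Fintype.piFinset fun i => Finset.Ico (if i = i₀ then 16 * d * n else 0 : ℤ)
    ((if i = i₀ then 16 * d * n else 0 : ℤ) + n)

theorem card_latticeBox (i₀ : Fin d) (n : ℕ) : (latticeBox i₀ n).card = n ^ d := by
  simp [latticeBox, Fintype.card_piFinset]

/-- Each coordinate is off by at most `n`, so the norm is at most `√d n ≤ d n`. The reference point
is `R v` with `R = 4 d n` and `‖v‖ = 4`. -/
theorem norm_latticePoint_sub_le {i₀ : Fin d} {n : ℕ} {j : Fin d → ℤ} (hj : j ∈ latticeBox i₀ n) :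
    ‖latticePoint j - (4 * d * n : ℝ) • (EuclideanSpace.single i₀ (4 : ℝ) : Space d)‖ ≤ d * n := by
  rw [latticeBox, Fintype.mem_piFinset] at hj
  refine (sq_le_sq₀ (norm_nonneg _) (by positivity)).mp ?_
  rw [EuclideanSpace.norm_sq_eq]
  calc _ ≤ ∑ _i : Fin d, (n : ℝ) ^ 2 := by
        refine Finset.sum_le_sum fun i _ => ?_
        have h := Finset.mem_Ico.mp (hj i)
        have h1 : ((if i = i₀ then 16 * d * n else 0 : ℤ) : ℝ) ≤ j i := by exact_mod_cast h.1
        have h2 : (j i : ℝ) < ((if i = i₀ then 16 * d * n else 0 : ℤ) : ℝ) + n := by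
          exact_mod_cast h.2
        have h3 : ((4 * d * n : ℝ) • (EuclideanSpace.single i₀ (4 : ℝ) : Space d)) i =
            ((if i = i₀ then 16 * d * n else 0 : ℤ) : ℝ) := by
          by_cases hi : i = i₀
          · subst hi
            simp
            ring
          · simp [hi]
        have h4 : (latticePoint j : Space d) i = j i := rfl
        rw [PiLp.sub_apply, h3, h4, Real.norm_eq_abs, sq_abs]
        gcongr
        linarith
    _ = d * (n : ℝ) ^ 2 := by simp
    _ ≤ (d * n) ^ 2 := by
      have : (1 : ℝ) ≤ d := by exact_mod_cast i₀.pos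
      have h5 : 0 ≤ (n : ℝ) ^ 2 := by positivity
      nlinarith [mul_nonneg (sub_nonneg.mpr this) h5]

end Box

/-! ### Infinitely many negative eigenvalues for a configuration of positive density. -/

section Deterministic

variable {d : ℕ}

theorem integrable_of_bounded_support {u : Space d → ℝ} {u₀ ρ : ℝ} (hum : AEMeasurable u volume)
    (hu : ∀ᵐ x, 0 ≤ u x ∧ u x ≤ u₀) (hρ : ∀ᵐ x, ρ < ‖x‖ → u x = 0) : Integrable u volume := by
  have h : u =ᵐ[volume] (Metric.closedBall 0 ρ).indicator u := by
    filter_upwards [hρ] with x hx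
    by_cases hxρ : x ∈ Metric.closedBall 0 ρ
    · rw [indicator_of_mem hxρ]
    · rw [indicator_of_notMem hxρ]
      exact hx (by simpa using hxρ)
  refine Integrable.congr ?_ h.symm
  rw [integrable_indicator_iff Metric.isClosed_closedBall.measurableSet]
  refine Measure.integrableOn_of_bounded (M := u₀) measure_closedBall_lt_top.ne
    hum.aestronglyMeasurable (ae_restrict_of_ae ?_)
  filter_upwards [hu] with x hx
  rw [Real.norm_eq_abs, abs_of_nonneg hx.1]
  exact hx.2

/-- The potential energy of a test function that equals one on the ball of radius `R` around a
point at distance `4 R` from the origin. -/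
theorem le_integral_mul_norm_sq {u γ : Space d → ℝ} {u₀ ρ B : ℝ} {w : (Fin d → ℤ) → ℝ}
    (hu : Integrable u volume) (hreg : ∀ᵐ x, RegularAt u u₀ ρ x) (hw : ∀ j, 0 ≤ w j)
    (hγ : ∀ᵐ x, 0 ≤ γ x)
    (hUm : AEMeasurable (fun x => γ x * -potential u w x) volume)
    (hUB : ∀ᵐ x, 0 ≤ γ x * -potential u w x ∧ γ x * -potential u w x ≤ B)
    {R₀ : ℝ} {F : ℝ → ℝ} (hF_pos : ∀ r, R₀ ≤ r → 0 < F r) (hF_mono : StrictMonoOn F (Ici R₀))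
    (hγF : ∀ᵐ x, R₀ < ‖x‖ → F ‖x‖ ≤ γ x * ‖x‖ ^ 2)
    {v : Space d} (hv : ‖v‖ = 4) {R : ℝ} (hR : 0 < R) (hRR₀ : R₀ < 3 * R)
    {A : Finset (Fin d → ℤ)} (hA : ∀ j ∈ A, ‖latticePoint j - R • v‖ + ρ ≤ R)
    {φ : 𝓢(Space d, ℂ)} (hφ : ∀ x ∈ Metric.closedBall (R • v) R, φ x = 1) :
    F (3 * R) / (5 * R) ^ 2 * ((∑ j ∈ A, w j) * ∫ x, u x) ≤
      ∫ x, γ x * -potential u w x * ‖φ x‖ ^ 2 := by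
  set c := F (3 * R) / (5 * R) ^ 2 with hc
  have hF0 : 0 < F (3 * R) := hF_pos _ hRR₀.le
  have hc0 : 0 ≤ c := by positivity
  have hint : ∀ j : Fin d → ℤ, Integrable (fun x => u (x - latticePoint j)) volume := fun j =>
    hu.comp_sub_right (latticePoint j)
  have hlhs : c * ((∑ j ∈ A, w j) * ∫ x, u x) =
      ∫ x, c * ∑ j ∈ A, w j * u (x - latticePoint j) := by
    rw [integral_const_mul, integral_finsetSum A fun j _ => (hint j).const_mul _, Finset.sum_mul]
    congr 1
    refine Finset.sum_congr rfl fun j _ => ?_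
    rw [integral_const_mul, integral_sub_right_eq_self u (latticePoint j)]
  have hφ2 : Integrable (fun x => ‖φ x‖ ^ 2) volume :=
    (φ.memLp 2 volume).integrable_norm_pow (by norm_num)
  rw [hlhs]
  refine integral_mono_ae ?_ ?_ ?_
  · exact (integrable_finsetSum A fun j _ => (hint j).const_mul _).const_mul _
  · refine Integrable.bdd_mul (c := B) hφ2 hUm.aestronglyMeasurable ?_
    filter_upwards [hUB] with x hx
    rw [Real.norm_eq_abs, abs_of_nonneg hx.1]
    exact hx.2
  · filter_upwards [hreg, hUB, hγ, hγF] with x h1 h2 h3 h4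
    by_cases hx : x ∈ Metric.closedBall (R • v) R
    · rw [hφ x hx, norm_one, one_pow, mul_one]
      have hRv : ‖R • v‖ = 4 * R := by
        rw [norm_smul, hv, Real.norm_eq_abs, abs_of_pos hR, mul_comm]
      rw [Metric.mem_closedBall, dist_eq_norm] at hx
      have hx3 : 3 * R ≤ ‖x‖ := by
        have := norm_sub_norm_le (R • v) x
        rw [norm_sub_rev] at this
        linarith
      have hx5 : ‖x‖ ≤ 5 * R := by
        have := norm_sub_norm_le x (R • v)
        linarith
      have hx0 : 0 < ‖x‖ := by linarith
      -- The ball lies in the shell `3 R ≤ ‖x‖ ≤ 5 R`.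
      have hcγ : c ≤ γ x := by
        rw [hc, div_le_iff₀ (by positivity)]
        calc F (3 * R) ≤ F ‖x‖ :=
              hF_mono.monotoneOn (mem_Ici.mpr hRR₀.le) (mem_Ici.mpr (hRR₀.le.trans hx3)) hx3
          _ ≤ γ x * ‖x‖ ^ 2 := h4 (hRR₀.trans_le hx3)
          _ ≤ γ x * (5 * R) ^ 2 := by gcongr
      exact mul_le_mul hcγ (h1.sum_le hw A)
        (Finset.sum_nonneg fun j _ => mul_nonneg (hw j) (h1.nonneg j)) h3
    · have h5 : ∑ j ∈ A, w j * u (x - latticePoint j) = 0 := by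
        refine Finset.sum_eq_zero fun j hj => ?_
        rw [h1.eq_zero j, mul_zero]
        rw [Metric.mem_closedBall, dist_eq_norm, not_le] at hx
        have h6 := hA j hj
        have h7 := norm_add_le (x - latticePoint j) (latticePoint j - R • v)
        rw [sub_add_sub_cancel] at h7
        linarith
      rw [h5, mul_zero]
      exact mul_nonneg h2.1 (sq_nonneg _)

theorem exists_ae_le_of_memLp_top {γ : Space d → ℝ} (hγ : MemLp γ ∞ volume) :
    ∃ Γ : ℝ, 0 ≤ Γ ∧ ∀ᵐ x, γ x ≤ Γ := by
  refine ⟨(eLpNormEssSup γ volume).toReal, ENNReal.toReal_nonneg, ?_⟩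
  have hfin : eLpNormEssSup γ volume ≠ ∞ := by
    rw [← eLpNorm_exponent_top]
    exact hγ.eLpNorm_ne_top
  filter_upwards [enorm_ae_le_eLpNormEssSup γ volume] with x hx
  have := ENNReal.toReal_mono hfin hx
  rw [toReal_enorm] at this
  exact (le_abs_self _).trans this

/-- The theorem for a fixed configuration of the coupling constants that has positive density in a
sequence of boxes. -/
theorem infinite_negative_eigenvalues_of_density (i₀ : Fin d) {w : (Fin d → ℤ) → ℝ}
    (hw : ∀ j, 0 ≤ w j ∧ w j ≤ 1) {p : ℝ} (hp : 0 < p)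
    (hdens : ∀ᶠ k : ℕ in atTop, p * (4 ^ k) ^ d ≤ ∑ j ∈ latticeBox i₀ (4 ^ k), w j)
    {u : Space d → ℝ} {u₀ : ℝ} (hum : AEMeasurable u volume)
    (hub : ∀ᵐ x, 0 ≤ u x ∧ u x ≤ u₀)
    (hus : ∃ K : Set (Space d), IsCompact K ∧ ∀ᵐ x, x ∉ K → u x = 0) (hui : 0 < ∫ x, u x)
    {γ : Space d → ℝ} (hγm : MemLp γ ∞ volume) (hγ : ∀ᵐ x, 0 ≤ γ x)
    (hγl : ∀ ε : ℝ, 0 < ε → ∃ R : ℝ, ∀ᵐ x, R < ‖x‖ → γ x < ε)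
    {R₀ : ℝ} {F : ℝ → ℝ} (hF_pos : ∀ r, R₀ ≤ r → 0 < F r) (hF_mono : StrictMonoOn F (Ici R₀))
    (hF_lim : Tendsto F atTop atTop) (hγF : ∀ᵐ x, R₀ < ‖x‖ → F ‖x‖ ≤ γ x * ‖x‖ ^ 2) :
    {E : ℝ | E < 0 ∧ IsEigenvalue (hamiltonian γ u w) E}.Infinite := by
  obtain ⟨K, hK, hKu⟩ := hus
  obtain ⟨ρ', hρ'⟩ := hK.isBounded.subset_closedBall 0
  set ρ := max ρ' 0 with hρdef
  have hρ : 0 ≤ ρ := le_max_right _ _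
  have hρu : ∀ᵐ x, ρ < ‖x‖ → u x = 0 := by
    filter_upwards [hKu] with x hx hxρ
    refine hx fun hxK => ?_
    have h1 := hρ' hxK
    rw [mem_closedBall_zero_iff] at h1
    exact absurd (h1.trans (le_max_left _ _)) (not_le.mpr hxρ)
  have hu₀ : 0 ≤ u₀ := by
    obtain ⟨x, hx⟩ := hub.exists
    exact hx.1.trans hx.2
  have hreg := ae_regularAt hub hρu
  obtain ⟨Γ, hΓ, hγΓ⟩ := exists_ae_le_of_memLp_top hγm
  set V₀ := (2 * ρ + 1) ^ d * u₀ with hV₀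
  have hV₀0 : 0 ≤ V₀ := by positivity
  set U : Space d → ℝ := fun x => γ x * -potential u w x with hU
  have hUm : AEMeasurable U volume :=
    hγm.1.aemeasurable.mul (aemeasurable_potential hum hreg).neg
  have hUB : ∀ᵐ x, 0 ≤ U x ∧ U x ≤ Γ * V₀ := by
    filter_upwards [hreg, hγ, hγΓ] with x h1 h2 h3
    have h4 := h1.neg_potential_nonneg fun j => (hw j).1
    exact ⟨mul_nonneg h2 h4, mul_le_mul h3 (h1.neg_potential_le hρ hu₀ hw) h4 hΓ⟩
  have hvan : ∀ ε : ℝ, 0 < ε → ∃ R : ℝ, ∀ᵐ x, R < ‖x‖ → U x ≤ ε := by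
    intro ε hε
    obtain ⟨R, hR⟩ := hγl (ε / (V₀ + 1)) (by positivity)
    refine ⟨R, ?_⟩
    filter_upwards [hreg, hγ, hR] with x h1 h2 h3 hx
    calc U x ≤ ε / (V₀ + 1) * V₀ := mul_le_mul (h3 hx).le (h1.neg_potential_le hρ hu₀ hw)
          (h1.neg_potential_nonneg fun j => (hw j).1) (by positivity)
      _ ≤ ε := by
        rw [div_mul_eq_mul_div, div_le_iff₀ (by positivity)]
        nlinarith
  have hUint : Integrable u volume := integrable_of_bounded_support hum hub hρu
  set v : Space d := EuclideanSpace.single i₀ (4 : ℝ) with hv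
  have hv4 : ‖v‖ = 4 := by simp [hv]
  obtain ⟨C, hC⟩ := exists_testFunction v
  have hd : (1 : ℝ) ≤ d := by exact_mod_cast i₀.pos
  -- With this scale the box of side `4 ^ k` lies within `R / 4` of `R v`; once `2 ρ ≤ R`, the bumps
  -- at its sites fit into the plateau.
  set R : ℕ → ℝ := fun k => 4 * d * (4 : ℝ) ^ k with hRdef
  have hRlim : Tendsto R atTop atTop :=
    (tendsto_pow_atTop_atTop_of_one_lt (by norm_num)).const_mul_atTop (by positivity)
  have hR1 : ∀ k, 1 ≤ R k := by
    intro k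
    have : (1 : ℝ) ≤ 4 ^ k := one_le_pow₀ (by norm_num)
    rw [hRdef]
    nlinarith
  choose φ hφs hφ1 hφe using fun k => hC (R k) (hR1 k)
  set I := ∫ x, u x
  have hFR : Tendsto (fun k => F (3 * R k)) atTop atTop :=
    hF_lim.comp (hRlim.const_mul_atTop (by norm_num))
  have hev : ∀ᶠ k in atTop, ‖(φ k).toLp 2 volume‖ * ‖(Δ (φ k)).toLp 2 volume‖ +
      2 * ‖(Δ (φ k)).toLp 2 volume‖ ^ 2 < 2⁻¹ * ∫ x, U x * ‖φ k x‖ ^ 2 := by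
    filter_upwards [hdens, hRlim.eventually_gt_atTop R₀, hRlim.eventually_ge_atTop (2 * ρ),
      -- In the constant `50`, a factor `25` comes from `(5 R) ^ 2` and a factor `2` from the `2⁻¹`
      -- in the criterion; `(4 d) ^ d` converts `4 ^ k` into `R`.
      hFR.eventually_gt_atTop (50 * (4 * d) ^ d / (p * I) * C)] with k h1 h2 h3 h4
    have hRk : 0 < R k := one_pos.trans_le (hR1 k)
    have hA : ∀ j ∈ latticeBox i₀ (4 ^ k), ‖latticePoint j - R k • v‖ + ρ ≤ R k := by
      intro j hj
      have h5 := norm_latticePoint_sub_le hj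
      push_cast at h5
      change ‖latticePoint j - R k • v‖ ≤ _ at h5
      have h6 : (d : ℝ) * 4 ^ k = R k / 4 := by
        rw [hRdef]
        ring
      linarith
    have h7 := le_integral_mul_norm_sq hUint hreg (fun j => (hw j).1) hγ hUm hUB hF_pos hF_mono
      hγF hv4 hRk (by linarith) hA (hφ1 k)
    have hpI : 0 < p * I := mul_pos hp hui
    have hF0 : 0 < F (3 * R k) := hF_pos _ (by linarith)
    have h8 : (4 : ℝ) ^ k = R k / (4 * d) := by
      rw [hRdef]
      field_simp
    have h9 : F (3 * R k) / (5 * R k) ^ 2 * (p * (R k / (4 * d)) ^ d * I) ≤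
        ∫ x, U x * ‖φ k x‖ ^ 2 := by
      refine le_trans ?_ h7
      rw [h8] at h1
      gcongr
    refine (hφe k).trans_lt ?_
    rw [div_mul_eq_mul_div, div_lt_iff₀ hpI] at h4
    have h10 : 0 < R k ^ d / R k ^ 2 / (50 * (4 * d) ^ d) := by positivity
    have h11 := mul_lt_mul_of_pos_left h4 h10
    have h12 : R k ^ d / R k ^ 2 / (50 * (4 * d) ^ d) * (50 * (4 * d) ^ d * C) =
        C * (R k ^ d / R k ^ 2) := by
      field_simp
    have h13 : R k ^ d / R k ^ 2 / (50 * (4 * d) ^ d) * (F (3 * R k) * (p * I)) =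
        2⁻¹ * (F (3 * R k) / (5 * R k) ^ 2 * (p * (R k / (4 * d)) ^ d * I)) := by
      rw [div_pow]
      field_simp
      ring
    rw [h12, h13] at h11
    linarith
  obtain ⟨k₀, hk₀⟩ := eventually_atTop.mp hev
  -- The support of `φ k` lies in `2 R k ≤ ‖x‖ ≤ 6 R k`, and `2 R l ≥ 8 R k` for `k < l`.
  have hsep : ∀ k l, k < l → Disjoint (tsupport (φ k)) (tsupport (φ l)) := by
    intro k l hkl
    refine Set.disjoint_left.mpr fun x hxk hxl => ?_
    have hxk' := hφs k hxk
    have hxl' := hφs l hxl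
    have hRv : ∀ k, ‖R k • v‖ = 4 * R k := fun k => by
      rw [norm_smul, hv4, Real.norm_eq_abs, abs_of_pos (one_pos.trans_le (hR1 k)), mul_comm]
    rw [Metric.mem_closedBall, dist_eq_norm] at hxk' hxl'
    have h1 := norm_sub_norm_le x (R k • v)
    have h2 := norm_sub_norm_le (R l • v) x
    rw [norm_sub_rev] at h2
    rw [hRv] at h1 h2
    have h3 : 4 * R k ≤ R l := by
      have h4 : (4 : ℝ) ^ (k + 1) ≤ 4 ^ l := pow_le_pow_right₀ (by norm_num) hkl
      rw [pow_succ] at h4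
      rw [hRdef]
      nlinarith
    have := hR1 k
    linarith
  have hres := infinite_negative_eigenvalues hUm hUB hvan (fun k => φ (k + k₀))
    (fun k l hkl => by
      rcases lt_or_gt_of_ne hkl with h | h
      · exact hsep _ _ (by omega)
      · exact (hsep _ _ (by omega)).symm)
    (fun k => hk₀ _ (Nat.le_add_left _ _))
  have hW : (fun x => -U x) = fun x => γ x * potential u w x := by
    funext x
    rw [hU]
    ring
  rw [hW] at hres
  exact hres

end Deterministic

/-! ### Almost sure positive density in growing boxes. -/

section Probability

variable {ι Ω : Type*} [MeasurableSpace Ω] {P : Measure Ω} [IsProbabilityMeasure P]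
  {X : ι → Ω → ℝ}

/-- Chebyshev's inequality; a variable with values in `[0, 1]` has variance at most `1 / 4`. -/
theorem measure_sum_lt_le (hm : ∀ j, Measurable (X j)) (hind : iIndepFun X P) {p : ℝ} (hp : 0 < p)
    (hmean : ∀ j, ∫ a, X j a ∂P = p) (hb : ∀ j, ∀ᵐ a ∂P, X j a ∈ Icc 0 1) {A : Finset ι}
    (hA : A.Nonempty) :
    P {a | ∑ j ∈ A, X j a < p / 2 * A.card} ≤ ENNReal.ofReal ((p ^ 2 * A.card)⁻¹) := by
  have hL2 : ∀ j, MemLp (X j) 2 P := fun j =>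
    memLp_of_bounded (hb j) (hm j).aestronglyMeasurable 2
  have hcard : (0 : ℝ) < A.card := by exact_mod_cast hA.card_pos
  have hsumL2 : MemLp (∑ j ∈ A, X j) 2 P := memLp_finsetSum' A fun j _ => hL2 j
  have hE : P[∑ j ∈ A, X j] = A.card * p := by
    simp only [Finset.sum_apply]
    rw [integral_finsetSum A fun j _ => (hL2 j).integrable (by norm_num),
      Finset.sum_congr rfl fun j _ => hmean j, Finset.sum_const, nsmul_eq_mul]
  have hvar : variance (∑ j ∈ A, X j) P ≤ A.card * (1 / 4) := by
    rw [IndepFun.variance_sum (fun j _ => hL2 j) fun i _ j _ hij => hind.indepFun hij]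
    calc ∑ j ∈ A, variance (X j) P ≤ ∑ _j ∈ A, (1 / 4 : ℝ) := by
          refine Finset.sum_le_sum fun j _ => ?_
          have := variance_le_sq_of_bounded (hb j) (hm j).aemeasurable
          norm_num at this ⊢
          exact this
      _ = A.card * (1 / 4) := by rw [Finset.sum_const, nsmul_eq_mul]
  have hc : 0 < p / 2 * A.card := by positivity
  calc P {a | ∑ j ∈ A, X j a < p / 2 * A.card}
      ≤ P {a | p / 2 * A.card ≤ |(∑ j ∈ A, X j) a - P[∑ j ∈ A, X j]|} := by
        refine measure_mono fun a ha => ?_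
        rw [mem_ofPred_eq] at ha ⊢
        rw [hE, Finset.sum_apply, abs_sub_comm]
        refine le_trans ?_ (le_abs_self _)
        linarith
    _ ≤ ENNReal.ofReal (variance (∑ j ∈ A, X j) P / (p / 2 * A.card) ^ 2) :=
        meas_ge_le_variance_div_sq hsumL2 hc
    _ ≤ ENNReal.ofReal ((p ^ 2 * A.card)⁻¹) := by
        refine ENNReal.ofReal_le_ofReal ?_
        rw [div_le_iff₀ (by positivity)]
        refine hvar.trans (le_of_eq ?_)
        field_simp
        norm_num

/-- Along a sequence of finite sets of exponentially growing size, the averages of independent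
variables with values in `[0, 1]` and mean `p` are almost surely eventually at least `p / 2`. -/
theorem ae_eventually_le_sum (hm : ∀ j, Measurable (X j)) (hind : iIndepFun X P) {p : ℝ}
    (hp : 0 < p) (hmean : ∀ j, ∫ a, X j a ∂P = p) (hb : ∀ j, ∀ᵐ a ∂P, X j a ∈ Icc 0 1)
    {A : ℕ → Finset ι} (hA : ∀ k, 4 ^ k ≤ (A k).card) :
    ∀ᵐ a ∂P, ∀ᶠ k in atTop, p / 2 * (A k).card ≤ ∑ j ∈ A k, X j a := by
  have hsummable : Summable fun k : ℕ => (p ^ 2)⁻¹ * (1 / 4 : ℝ) ^ k :=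
    (summable_geometric_of_lt_one (by norm_num) (by norm_num)).mul_left _
  -- The exceptional probabilities are at most `p⁻² 4⁻ᵏ`, so Borel–Cantelli applies.
  have hne : ∑' k, P {a | ∑ j ∈ A k, X j a < p / 2 * (A k).card} ≠ ∞ := by
    refine ne_top_of_le_ne_top hsummable.tsum_ofReal_ne_top (ENNReal.tsum_le_tsum fun k => ?_)
    have hk : (4 : ℝ) ^ k ≤ (A k).card := by exact_mod_cast hA k
    have hne : (A k).Nonempty := Finset.card_pos.mp ((pow_pos (by norm_num) k).trans_le (hA k))
    refine (measure_sum_lt_le hm hind hp hmean hb hne).trans (ENNReal.ofReal_le_ofReal ?_)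
    rw [mul_inv, one_div, inv_pow]
    gcongr
  filter_upwards [ae_eventually_notMem hne] with a ha
  filter_upwards [ha] with k hk
  exact not_lt.mp hk

end Probability

end RandomSchrodinger

end

/-! ### The random operator: almost sure density combined with the deterministic result. -/

theorem theorem2p1 {d : ℕ} (hd : 1 ≤ d)
    {Ω : Type*} [MeasurableSpace Ω] (P : Measure Ω) [IsProbabilityMeasure P]
    -- the i.i.d. coupling constants
    (ω : (Fin d → ℤ) → Ω → ℝ)
    (hω_meas : ∀ j, Measurable (ω j))
    (hω_indep : iIndepFun ω P)
    (hω_ident : ∀ j, IdentDistrib (ω j) (ω 0) P P)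
    (hω_bound : ∀ᵐ a ∂P, 0 ≤ ω 0 a ∧ ω 0 a ≤ 1)
    (hω_mean : 0 < ∫ a, ω 0 a ∂P)
    -- the single-site potential
    (u : RandomSchrodinger.Space d → ℝ) (u₀ : ℝ)
    (hu_meas : AEMeasurable u volume)
    (hu_bound : ∀ᵐ x, 0 ≤ u x ∧ u x ≤ u₀)
    (hu_supp : ∃ K : Set (RandomSchrodinger.Space d), IsCompact K ∧ ∀ᵐ x, x ∉ K → u x = 0)
    (hu_int : 0 < ∫ x, u x)
    -- the envelope function
    (γ : RandomSchrodinger.Space d → ℝ)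
    (hγ_mem : MemLp γ ∞ volume)
    (hγ_nonneg : ∀ᵐ x, 0 ≤ γ x)
    (hγ_lim : ∀ ε : ℝ, 0 < ε → ∃ R : ℝ, ∀ᵐ x, R < ‖x‖ → γ x < ε)
    -- the lower bound on the envelope function
    (R₀ : ℝ) (hR₀ : 0 < R₀) (F : ℝ → ℝ)
    (hF_pos : ∀ r, R₀ ≤ r → 0 < F r)
    (hF_mono : StrictMonoOn F (Ici R₀))
    (hF_lim : Tendsto F atTop atTop)
    (hF_growth : Tendsto (fun r => F r / r ^ 2) atTop (𝓝 0))
    (hγF : ∀ᵐ x, R₀ < ‖x‖ → F ‖x‖ ≤ γ x * ‖x‖ ^ 2) :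
    ∀ᵐ a ∂P, {E : ℝ | E < 0 ∧
      RandomSchrodinger.IsEigenvalue
        (RandomSchrodinger.hamiltonian γ u (fun j => ω j a)) E}.Infinite := by
  have hb : ∀ j, ∀ᵐ a ∂P, ω j a ∈ Icc 0 1 := fun j =>
    (hω_ident j).symm.ae_mem_snd measurableSet_Icc hω_bound
  have hmean : ∀ j, ∫ a, ω j a ∂P = ∫ a, ω 0 a ∂P := fun j => (hω_ident j).integral_eq
  have hd0 : d ≠ 0 := by omega
  have hdens := RandomSchrodinger.ae_eventually_le_sum hω_meas hω_indep hω_mean hmean hb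
    (A := fun k => RandomSchrodinger.latticeBox ⟨0, hd⟩ (4 ^ k)) (fun k => by
      rw [RandomSchrodinger.card_latticeBox]
      exact le_self_pow₀ (Nat.one_le_pow _ _ (by norm_num)) hd0)
  filter_upwards [hdens, ae_all_iff.mpr hb] with a ha hba
  refine RandomSchrodinger.infinite_negative_eigenvalues_of_density ⟨0, hd⟩ (fun j => hba j)
    (half_pos hω_mean) ?_ hu_meas hu_bound hu_supp hu_int hγ_mem hγ_nonneg hγ_lim hF_pos hF_mono
    hF_lim hγF
  filter_upwards [ha] with k hk
  rw [RandomSchrodinger.card_latticeBox] at hk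
  exact_mod_cast hk
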